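/- **Setting.** Let $V$ be a finite vertex set of a complete graph whose edges are split into positive edges $E^+$ and negative edges $E^-$, with weights $w_{uv}$ such that, for some $\alpha\in(0,1]$ and $\mathbf w>0$, $w_{uv}\in[\alpha\mathbf w,\mathbf w]$ for $(u,v)\in E^+$ and $w_{uv}\ge\alpha\mathbf w$ for $(u,v)\in E^-$. For a partition $\mathcal P$ of $V$ let $$\operatorname{dis}_u(\mathcal P)=\sum_{v:(u,v)\in E^+}w_{uv}\mathbf 1\{\mathcal P(u)\ne\mathcal P(v)\}+\sum_{v:(u,v)\in E^-}w_{uv}\mathbf 1\{\mathcal P(u)=\mathcal P(v)\}.$$ Let $(x,y)$ be a feasible solution (in particular, an optimal one for any $\ell_p$ objective) of the convex relaxation: $y_u=\sum_{v:(u,v)\in E^+}w_{uv}x_{uv}+\sum_{v:(u,v)\in E^-}w_{uv}(1-x_{uv})$ for all $u$; $x_{v_1v_3}\le x_{v_1v_2}+x_{v_2v_3}$; $x_{uv}=x_{vu}$; $x_{uv}\in[0,1]$. Let $d(u,v)=x_{uv}$ for $u\neq v$ and $d(u,u)=0$. **Algorithm** with parameter $a\in(0,1)$. Put $r=\sqrt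 a/\ln(1/a)$, $R=1/3$, $q=2$, $\beta=r/R$, $D=2(q+1)\ln(1/\beta)$, $R_0=R/D$, $R_1=R-R_0$. Start with $Y=V$. While $Y\ne\varnothing$, select a cluster $P\subseteq Y$ as follows, output it, and replace $Y$ by $Y\setminus P$. All balls are closed balls $\operatorname{Ball}(u,l)=\{v\in Y:d(u,v)\le l\}$ in $Y$. Choose $z\in Y$ that maximizes $|\operatorname{Ball}(z,R_0)|$ (ties are broken by any fixed function of $Y$). If $|\operatorname{Ball}(z,R_1)|\ge\beta^{-(q+1)}|\operatorname{Ball}(z,R_0)|$, let $P=\operatorname{Ball}(z,R_1)$. Otherwise let $S$ be the set of all $s\in(3R_0,R_1]$ such that $Q=\operatorname{Ball}(z,s)$ satisfies, for every $u\in Y$, $$\sum_{v\in\operatorname{Ball}(u,r)}\mathbf 1\{\mathbf 1_Q(u)\ne\mathbf 1_Q(v)\}\le25\beta D^2\sum_{v\in\operatorname{Ball}(u,2R)}\frac{d(u,v)}R\,\mathbf 1\{u\in Q\text{ or }v\in Q\};$$ draw, independently of the previous iterations, a random $\xi\in[0,R/2]$ with cumulative distribution function $F(\xi)=\frac{1-e^{-\xi/R_0}}{1-e^{-R/(2R_0)}}$,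 and let $P=\operatorname{Ball}(z,t)$, where $t=\min\{s\in[0,R]:\mu([0,s]\cap S)=\xi\}$ and $\mu$ is Lebesgue measure. **Theorem.** There are absolute constants $\alpha^*\in(0,1)$ with $3\sqrt{\alpha^*}/\ln(1/\alpha^*)<1$ and $C>0$ such that for every instance and every feasible $(x,y)$ as above, the algorithm with parameter $a=\min(\alpha,\alpha^*)$ (so $a=\alpha$ whenever $\alpha\le\alpha^*$) outputs a partition $\mathcal P$ of $V$ such that for every $u\in V$: (a) with probability one, $\operatorname{dis}_u(\mathcal P)\le C\,\frac{\ln(1/a)}{\sqrt a}\,y_u$; (b) $\mathbf E[\operatorname{dis}_u(\mathcal P)]\le C\,\ln(1/a)\,y_u$. -/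

import Mathlib

open MeasureTheory

namespace CorrClust

/-- An instance of Correlation Clustering with Asymmetric Classification Errors on the complete
graph with vertex set `V`: `pos` is the graph of positive edges, the negative edges are all the
remaining pairs of distinct vertices, `weight e` is the weight of the edge `e`. Positive weights
lie in `[α * scale, scale]`, negative weights are at least `α * scale`. -/
structure Instance (V : Type*) where
  pos : SimpleGraph V
  weight : Sym2 V → ℝ
  α : ℝ
  scale : ℝ
  α_pos : 0 < α
  α_le_one : α ≤ 1
  scale_pos : 0 < scale
  pos_lower : ∀ u v, pos.Adj u v → α * scale ≤ weight s(u, v)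
  pos_upper : ∀ u v, pos.Adj u v → weight s(u, v) ≤ scale
  neg_lower : ∀ u v, posᶜ.Adj u v → α * scale ≤ weight s(u, v)

section Objective

variable {V : Type*} [Fintype V]

/-- `u` and `v` lie in a common cluster of the clustering `𝒞`. -/
def SameCluster (𝒞 : Set (Set V)) (u v : V) : Prop := ∃ P ∈ 𝒞, u ∈ P ∧ v ∈ P

open Classical in
/-- The weight of the disagreements of the clustering `𝒞` at the vertex `u`. -/
noncomputable def dis (G : Instance V) (𝒞 : Set (Set V)) (u : V) : ℝ :=
  (∑ v, if G.pos.Adj u v ∧ ¬ SameCluster 𝒞 u v then G.weight s(u, v) else 0) +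
    ∑ v, if G.posᶜ.Adj u v ∧ SameCluster 𝒞 u v then G.weight s(u, v) else 0

open Classical in
/-- Feasibility of `(x, y)` for the convex relaxation. -/
structure IsFeasible (G : Instance V) (x : V → V → ℝ) (y : V → ℝ) : Prop where
  cost : ∀ u, y u = (∑ v, if G.pos.Adj u v then G.weight s(u, v) * x u v else 0) +
    ∑ v, if G.posᶜ.Adj u v then G.weight s(u, v) * (1 - x u v) else 0
  triangle : ∀ v₁ v₂ v₃, x v₁ v₃ ≤ x v₁ v₂ + x v₂ v₃
  symm : ∀ u v, x u v = x v u
  nonneg : ∀ u v, 0 ≤ x u v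
  le_one : ∀ u v, x u v ≤ 1

open Classical in
/-- The (pseudo)metric defined by `x`. The constraints of the relaxation say nothing about the
irrelevant diagonal entries `x u u`, which are read as zero. -/
noncomputable def metricOf (x : V → V → ℝ) (u v : V) : ℝ := if u = v then 0 else x u v

end Objective

/-- The parameters of the metric partitioning scheme. -/
structure Params where
  r : ℝ
  R : ℝ
  q : ℝ

namespace Params

noncomputable def β (p : Params) : ℝ := p.r / p.R

noncomputable def D (p : Params) : ℝ := 2 * (p.q + 1) * Real.log (1 / p.β)

noncomputable def R₀ (p : Params) : ℝ := p.R / p.D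

noncomputable def R₁ (p : Params) : ℝ := p.R - p.R₀

noncomputable def ρ (p : Params) : ℝ := (1 / p.β) ^ (p.q + 1)

/-- The cumulative distribution function `F` on `[0, R / 2]`. -/
noncomputable def F (p : Params) (x : ℝ) : ℝ :=
  (1 - Real.exp (-x / p.R₀)) / (1 - Real.exp (-p.R / (2 * p.R₀)))

theorem F_monotoneOn (p : Params) : MonotoneOn p.F (Set.Icc 0 (p.R / 2)) := by
  intro a ha b hb hab
  have hR : 0 ≤ p.R := by linarith [ha.1, ha.2]
  have e : -p.R / (2 * p.R₀) = -(p.R / 2) / p.R₀ := by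
    rw [← neg_div, div_div]
  unfold F
  rw [e]
  rcases le_total 0 p.R₀ with h | h
  · refine div_le_div_of_nonneg_right ?_ ?_
    · have : -b / p.R₀ ≤ -a / p.R₀ := div_le_div_of_nonneg_right (by linarith) h
      linarith [Real.exp_le_exp.2 this]
    · have : -(p.R / 2) / p.R₀ ≤ 0 := div_nonpos_of_nonpos_of_nonneg (by linarith) h
      linarith [Real.exp_le_one_iff.2 this]
  · refine div_le_div_of_nonpos_of_le ?_ ?_
    · have : 0 ≤ -(p.R / 2) / p.R₀ := div_nonneg_of_nonpos (by linarith) h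
      linarith [Real.one_le_exp this]
    · have : -a / p.R₀ ≤ -b / p.R₀ := div_le_div_of_nonpos_of_le h (by linarith)
      linarith [Real.exp_le_exp.2 this]

/-- `F`, extended to the real line by its values at the end points of `[0, R / 2]`. -/
noncomputable def stieltjesF (p : Params) : StieltjesFunction ℝ where
  toFun x := p.F (max 0 (min x (p.R / 2)))
  mono' := by
    intro a b hab
    rcases le_total 0 (p.R / 2) with h | h
    · exact p.F_monotoneOn ⟨le_max_left _ _, max_le h (min_le_right _ _)⟩
        ⟨le_max_left _ _, max_le h (min_le_right _ _)⟩
        (max_le_max le_rfl (min_le_min hab le_rfl))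
    · have : ∀ x : ℝ, max 0 (min x (p.R / 2)) = 0 := fun x =>
        max_eq_left ((min_le_right _ _).trans h)
      simp only [this, le_refl]
  right_continuous' := by
    intro x
    refine Continuous.continuousWithinAt ?_
    unfold F
    fun_prop

/-- The law of a random number in `[0, R / 2]` with cumulative distribution function `F`. -/
noncomputable def radiusLaw (p : Params) : Measure ℝ := p.stieltjesF.measure

/-- The law of a sequence of independent random numbers with cumulative distribution function `F`,
one for each iteration of the partitioning scheme. -/
noncomputable def seedLaw (p : Params) : Measure (ℕ → ℝ) :=
  Measure.infinitePi fun _ => p.radiusLaw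

end Params

/-- `π_S x = μ([0, x] ∩ S)`. -/
noncomputable def piMap (S : Set ℝ) (x : ℝ) : ℝ := volume.real (Set.Icc 0 x ∩ S)

/-- `π_S^inv y`, the smallest `x` in `[0, R]` such that `π_S x = y`. -/
noncomputable def piInv (R : ℝ) (S : Set ℝ) (y : ℝ) : ℝ :=
  sInf {x | x ∈ Set.Icc 0 R ∧ piMap S x = y}

section Scheme

variable {V : Type*} (d : V → V → ℝ) (p : Params)

open Classical in
/-- The closed ball of radius `l` around `u` in the subspace `Y`. -/
noncomputable def ball (Y : Finset V) (u : V) (l : ℝ) : Finset V := Y.filter fun v => d u v ≤ l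

open Classical in
/-- The cut metric of `P`. -/
noncomputable def cut (P : Finset V) (u v : V) : ℝ :=
  if (u ∈ P ∧ v ∉ P) ∨ (u ∉ P ∧ v ∈ P) then 1 else 0

open Classical in
/-- The indicator of the event that at least one of `u`, `v` lies in `P`. -/
noncomputable def touch (P : Finset V) (u v : V) : ℝ := if u ∈ P ∨ v ∈ P then 1 else 0

/-- The set `S` of the good radii around `z` in the space `Y`. -/
def goodRadii (Y : Finset V) (z : V) : Set ℝ :=
  {s | s ∈ Set.Ioc (3 * p.R₀) p.R₁ ∧ ∀ u ∈ Y,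
    ∑ v ∈ ball d Y u p.r, cut (ball d Y z s) u v ≤
      25 * p.β * p.D ^ 2 *
        ∑ v ∈ ball d Y u (2 * p.R), d u v / p.R * touch (ball d Y z s) u v}

/-- `pivot` selects from every nonempty subspace `Y` a point whose ball of radius `R₀` in `Y` is
largest (ties may be broken in any way). -/
def IsPivotRule (pivot : Finset V → V) : Prop :=
  ∀ Y : Finset V, Y.Nonempty → pivot Y ∈ Y ∧
    ∀ u ∈ Y, (ball d Y u p.R₀).card ≤ (ball d Y (pivot Y) p.R₀).card

variable (pivot : Finset V → V)

open Classical in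
/-- One cluster, selected from the space `Y`, where `x` is the random number that is used if the
large ball around the pivot is light. -/
noncomputable def clusterSelect (Y : Finset V) (x : ℝ) : Finset V :=
  if p.ρ * ((ball d Y (pivot Y) p.R₀).card : ℝ) ≤ ((ball d Y (pivot Y) p.R₁).card : ℝ) then
    ball d Y (pivot Y) p.R₁
  else
    ball d Y (pivot Y) (piInv p.R (goodRadii d p Y (pivot Y)) x)

variable [Fintype V]

open Classical in
/-- The points that are not clustered yet after `t` iterations, if `ω t` is the random number that
is drawn for the iteration with index `t = 0, 1, 2, …`. -/
noncomputable def remaining (ω : ℕ → ℝ) : ℕ → Finset V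
  | 0 => Finset.univ
  | t + 1 => remaining ω t \ clusterSelect d p pivot (remaining ω t) (ω t)

/-- The clusters that the partitioning scheme outputs: those selected in the iterations that start
while some point is not clustered yet. -/
def partitionScheme (ω : ℕ → ℝ) : Set (Set V) :=
  {P | ∃ t, (remaining d p pivot ω t).Nonempty ∧
    P = ↑(clusterSelect d p pivot (remaining d p pivot ω t) (ω t))}

end Scheme

/-- The parameters that the clustering algorithm passes to the partitioning scheme. -/
noncomputable def algParams (α : ℝ) : Params where
  r := √α / Real.log (1 / α)
  R := 1 / 3
  q := 2

end CorrClust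

namespace CorrClust

open Filter Topology

/-! The proof is a step-by-step charging argument. When a cluster `P` is cut out of the remaining
set `Y`, the disagreements created at `u` are the positive edges cut by `P` and the negative edges
inside `P`. They are charged to the fractional cost of the pairs at `u` that `P` touches. Each pair
is touched exactly once before it leaves, so the payments of all steps add up to exactly `y u`. It
is therefore enough to bound cost by payment for one step from an arbitrary fixed `Y`, surely
(`IsFeasible.stepCost_le_ae`) and in expectation (`IsFeasible.integral_stepCost_le`). Independence
of the draws transfers the second bound to the process.

Negative edges inside a cluster of radius at most 1/3 have `1 - x ≥ 1/3` and pay for themselves.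
Positive pairs at distance more than a scale `s` pay for themselves at rate `1 / s`, so only the
near pairs matter.

If the large ball around the pivot `z` is heavy, a point `u` with a near cut pair is neither very
close to `z` nor beyond `R`. By maximality of `Ball(z, R₀)`, a constant fraction of the mass of the
large ball is at distance at least `R₀` from `u`, and this mass pays for the at most `|Ball(z, R₀)|`
near pairs with a factor `ρ` to spare.

If it is light, the logarithm of the ball size grows by at most `log ρ = D / 2`. A bad radius forces
growth by a factor `1 + 25/2 * β * D` within distance `r`, so the good radii have measure at least
`R / 2`. Good radii give the sure bound at scale `r`. The exponential law gives the expected bound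
at scale `R₀`: a pair is cut with probability at most `d / R₀` times the probability that it is
touched, up to a truncation error `2 / ρ` that is paid for by mass as in the heavy case. -/

/-- The relations between the parameters under which the partitioning scheme is analysed. -/
structure Params.Tame (p : Params) : Prop where
  r_pos : 0 < p.r
  R_pos : 0 < p.R
  D_ge : 20 ≤ p.D
  r_le : p.r ≤ p.R₀
  small : 25 * p.β * p.D ≤ 2

/-! ### Parameter identities and the truncated exponential law. -/

namespace Params.Tame

variable {p : Params}

theorem D_pos (h : p.Tame) : 0 < p.D := by linarith [h.D_ge]

theorem R₀_pos (h : p.Tame) : 0 < p.R₀ := div_pos h.R_pos h.D_pos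

theorem β_pos (h : p.Tame) : 0 < p.β := div_pos h.r_pos h.R_pos

theorem R₀_mul_D (h : p.Tame) : p.R₀ * p.D = p.R := div_mul_cancel₀ _ h.D_pos.ne'

theorem R_eq_β (h : p.Tame) : p.β * p.R = p.r := div_mul_cancel₀ _ h.R_pos.ne'

theorem R₀_le (h : p.Tame) : 20 * p.R₀ ≤ p.R := by
  rw [← h.R₀_mul_D]
  nlinarith [h.R₀_pos, h.D_ge]

theorem ρ_eq (h : p.Tame) : p.ρ = Real.exp (p.D / 2) := by
  unfold Params.ρ Params.D
  rw [Real.rpow_def_of_pos (one_div_pos.2 h.β_pos)]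
  congr 1
  ring

theorem ρ_ge (h : p.Tame) : 2 ≤ p.ρ := by
  rw [h.ρ_eq]
  linarith [Real.add_one_le_exp (p.D / 2), h.D_ge]

theorem ρ_pos (h : p.Tame) : 0 < p.ρ := by linarith [h.ρ_ge]

/-- The tail removed by truncating at `R / 2` is the inverse of the heaviness threshold, so
truncation errors and mass bounds are measured in the same unit. -/
theorem exp_eq (h : p.Tame) : Real.exp (-p.R / (2 * p.R₀)) = 1 / p.ρ := by
  rw [h.ρ_eq, one_div, ← Real.exp_neg, ← h.R₀_mul_D]
  congr 1
  field_simp [h.R₀_pos.ne']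

theorem stieltjesF_of_nonpos (p : Params) {x : ℝ} (hx : x ≤ 0) : p.stieltjesF x = 0 := by
  have : max 0 (min x (p.R / 2)) = 0 := max_eq_left ((min_le_left _ _).trans hx)
  change p.F (max 0 (min x (p.R / 2))) = 0
  rw [this]
  simp [Params.F]

theorem stieltjesF_of_le (h : p.Tame) {x : ℝ} (hx : p.R / 2 ≤ x) : p.stieltjesF x = 1 := by
  have hR := h.R_pos
  have : max 0 (min x (p.R / 2)) = p.R / 2 := by
    rw [min_eq_right hx, max_eq_right (by linarith)]
  change p.F (max 0 (min x (p.R / 2))) = 1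
  have e : -(p.R / 2) / p.R₀ = -p.R / (2 * p.R₀) := by
    have := h.R₀_pos.ne'
    field_simp
  have hρ := h.ρ_ge
  rw [this, Params.F, e, h.exp_eq, div_self]
  have : 1 / p.ρ ≤ 1 / 2 := one_div_le_one_div_of_le (by norm_num) hρ
  linarith

theorem isProbabilityMeasure_radiusLaw (h : p.Tame) : IsProbabilityMeasure p.radiusLaw := by
  refine StieltjesFunction.isProbabilityMeasure _ ?_ ?_
  · refine tendsto_const_nhds.congr' ?_
    filter_upwards [eventually_le_atBot 0] with x hx
    exact (stieltjesF_of_nonpos p hx).symm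
  · refine tendsto_const_nhds.congr' ?_
    filter_upwards [eventually_ge_atTop (p.R / 2)] with x hx
    exact (h.stieltjesF_of_le hx).symm

theorem isProbabilityMeasure_seedLaw (h : p.Tame) : IsProbabilityMeasure p.seedLaw := by
  have := h.isProbabilityMeasure_radiusLaw
  unfold Params.seedLaw
  infer_instance

theorem continuous_stieltjesF (p : Params) : Continuous p.stieltjesF := by
  change Continuous fun x => p.F (max 0 (min x (p.R / 2)))
  unfold Params.F
  fun_prop

theorem leftLim_stieltjesF (p : Params) (x : ℝ) :
    Function.leftLim p.stieltjesF x = p.stieltjesF x :=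
  (continuous_stieltjesF p).continuousAt.continuousWithinAt.leftLim_eq

theorem nullSingletonClass_radiusLaw (p : Params) : NullSingletonClass p.radiusLaw where
  measure_singleton x := by
    rw [Params.radiusLaw, StieltjesFunction.measure_singleton, leftLim_stieltjesF]
    simp

theorem radiusLaw_Icc (p : Params) {s t : ℝ} (hst : s ≤ t) :
    p.radiusLaw.real (Set.Icc s t) = p.stieltjesF t - p.stieltjesF s := by
  rw [Measure.real, Params.radiusLaw, StieltjesFunction.measure_Icc, leftLim_stieltjesF,
    ENNReal.toReal_ofReal]
  linarith [p.stieltjesF.mono hst]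

theorem radiusLaw_Ioi (h : p.Tame) (s : ℝ) :
    p.radiusLaw.real (Set.Ioi s) = 1 - p.stieltjesF s := by
  have := h.isProbabilityMeasure_radiusLaw
  have := nullSingletonClass_radiusLaw p
  set b := max s (p.R / 2)
  have hb : p.stieltjesF b = 1 := h.stieltjesF_of_le (le_max_right _ _)
  have h1 : p.radiusLaw (Set.Ioi b) = 0 := by
    have hp : p.radiusLaw Set.univ = 1 := measure_univ
    refine nonpos_iff_eq_zero.1 ?_
    rw [Params.radiusLaw, StieltjesFunction.measure_Ioi (l := 1)]
    · simp [hb]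
    · refine tendsto_const_nhds.congr' ?_
      filter_upwards [eventually_ge_atTop (p.R / 2)] with x hx
      exact (h.stieltjesF_of_le hx).symm
  have h2 : p.radiusLaw (Set.Ioi s) = p.radiusLaw (Set.Ioc s b) := by
    refine le_antisymm ?_ (measure_mono Set.Ioc_subset_Ioi_self)
    rw [← Set.Ioc_union_Ioi_eq_Ioi (le_max_left s (p.R / 2))]
    exact (measure_union_le _ _).trans (by rw [h1, add_zero])
  rw [Measure.real, h2, Params.radiusLaw, StieltjesFunction.measure_Ioc, hb,
    ENNReal.toReal_ofReal]
  rw [← hb]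
  linarith [p.stieltjesF.mono (le_max_left s (p.R / 2))]

theorem ae_mem_Ioc (h : p.Tame) : ∀ᵐ x ∂p.radiusLaw, x ∈ Set.Ioc 0 (p.R / 2) := by
  have := h.isProbabilityMeasure_radiusLaw
  have hm : p.radiusLaw (Set.Ioc 0 (p.R / 2)) = 1 := by
    rw [Params.radiusLaw, StieltjesFunction.measure_Ioc, stieltjesF_of_nonpos p le_rfl,
      h.stieltjesF_of_le le_rfl]
    simp
  exact (prob_compl_eq_zero_iff measurableSet_Ioc).2 hm

/-- The padding property of the truncated exponential distribution. -/
theorem stieltjesF_sub_le (h : p.Tame) {s t δ : ℝ} (hst : s ≤ t) (hδ : t ≤ s + δ) :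
    p.stieltjesF t - p.stieltjesF s ≤ δ / p.R₀ * (1 - p.stieltjesF s + 2 / p.ρ) := by
  have hR := h.R_pos
  have hR₀ := h.R₀_pos
  have hρ := h.ρ_ge
  set s' := max 0 (min s (p.R / 2)) with hs'
  set t' := max 0 (min t (p.R / 2)) with ht'
  have hst' : s' ≤ t' := max_le_max le_rfl (min_le_min hst le_rfl)
  have htδ : t' ≤ s' + δ := by
    have hδ0 : 0 ≤ δ := by linarith
    refine max_le (by linarith [le_max_left 0 (min s (p.R / 2))]) ?_
    have : min t (p.R / 2) ≤ min s (p.R / 2) + δ := by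
      rcases le_total s (p.R / 2) with h1 | h1
      · rw [min_eq_left h1]; exact (min_le_left _ _).trans hδ
      · rw [min_eq_right h1]; linarith [min_le_right t (p.R / 2)]
    linarith [le_max_right 0 (min s (p.R / 2))]
  change p.F t' - p.F s' ≤ δ / p.R₀ * (1 - p.F s' + 2 / p.ρ)
  unfold Params.F
  rw [h.exp_eq]
  set ε := 1 / p.ρ with hε
  have hε2 : ε ≤ 1 / 2 := one_div_le_one_div_of_le (by norm_num) hρ
  have hε0 : 0 < ε := one_div_pos.2 h.ρ_pos
  have e2 : 2 / p.ρ = 2 * ε := by rw [hε]; ring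
  rw [e2]
  have hk : 0 < 1 - ε := by linarith
  set A := Real.exp (-s' / p.R₀) with hA
  set B := Real.exp (-t' / p.R₀) with hB
  have hA0 : 0 < A := Real.exp_pos _
  have hAB : A - B ≤ δ / p.R₀ * A := by
    have e : B = A * Real.exp (-(t' - s') / p.R₀) := by
      rw [hA, hB, ← Real.exp_add]; congr 1; ring
    have h1 := Real.add_one_le_exp (-(t' - s') / p.R₀)
    have h2 : (t' - s') / p.R₀ ≤ δ / p.R₀ := div_le_div_of_nonneg_right (by linarith) hR₀.le
    rw [neg_div] at h1
    rw [neg_div] at e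
    rw [e]
    nlinarith
  have hδ0 : 0 ≤ δ / p.R₀ := div_nonneg (by linarith) hR₀.le
  have e3 : (1 - B) / (1 - ε) - (1 - A) / (1 - ε) = (A - B) / (1 - ε) := by ring
  rw [e3, div_le_iff₀ hk]
  have e4 : δ / p.R₀ * (1 - (1 - A) / (1 - ε) + 2 * ε) * (1 - ε) =
      δ / p.R₀ * (A - ε + 2 * ε * (1 - ε)) := by
    field_simp
    ring
  rw [e4]
  -- What is left is `ε ≤ 2 * ε * (1 - ε)`, that is `ε ≤ 1 / 2`; this is where the 2 in `2 / ρ`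
  -- comes from.
  refine hAB.trans (mul_le_mul_of_nonneg_left ?_ hδ0)
  nlinarith

end Params.Tame

/-! ### The change of variable between random numbers and radii. -/

section RadiusMap

variable {S : Set ℝ} {R : ℝ}

theorem volume_Icc_inter_ne_top (S : Set ℝ) (x : ℝ) : volume (Set.Icc 0 x ∩ S) ≠ ⊤ :=
  ((measure_mono Set.inter_subset_left).trans_lt (by simp)).ne

theorem piMap_mono (S : Set ℝ) : Monotone (piMap S) := fun _ y hxy =>
  ENNReal.toReal_mono (volume_Icc_inter_ne_top S y)
    (measure_mono (Set.inter_subset_inter_left _ (Set.Icc_subset_Icc_right hxy)))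

theorem piMap_of_nonpos (S : Set ℝ) {x : ℝ} (hx : x ≤ 0) : piMap S x = 0 := by
  have : volume (Set.Icc 0 x ∩ S) = 0 := by
    refine measure_mono_null Set.inter_subset_left ?_
    simp [hx]
  simp [piMap, Measure.real, this]

/-- The map `π_S` is 1-Lipschitz. -/
theorem piMap_le_add (S : Set ℝ) {x y : ℝ} (hxy : x ≤ y) : piMap S y ≤ piMap S x + (y - x) := by
  have hsub : Set.Icc 0 y ∩ S ⊆ (Set.Icc 0 x ∩ S) ∪ Set.Icc x y := by
    rintro t ⟨ht, htS⟩
    rcases le_total t x with h | h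
    · exact Or.inl ⟨⟨ht.1, h⟩, htS⟩
    · exact Or.inr ⟨h, ht.2⟩
  have h1 : (volume (Set.Icc x y)).toReal = y - x := by simp [hxy]
  rw [← h1, piMap, piMap, Measure.real, Measure.real,
    ← ENNReal.toReal_add (volume_Icc_inter_ne_top S x) (by simp)]
  exact ENNReal.toReal_mono (ENNReal.add_ne_top.2 ⟨volume_Icc_inter_ne_top S x, by simp⟩)
    ((measure_mono hsub).trans (measure_union_le _ _))

/-- The map `π_S` does not grow on an interval that misses `S`. -/
theorem piMap_eq_of_disjoint {x y : ℝ} (hxy : x ≤ y) (h : ∀ t ∈ Set.Ioc x y, t ∉ S) :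
    piMap S y = piMap S x := by
  have : Set.Icc 0 y ∩ S = Set.Icc 0 x ∩ S := by
    ext t
    constructor
    · rintro ⟨ht, htS⟩
      refine ⟨⟨ht.1, ?_⟩, htS⟩
      by_contra hlt
      exact h t ⟨not_le.1 hlt, ht.2⟩ htS
    · rintro ⟨ht, htS⟩
      exact ⟨⟨ht.1, ht.2.trans hxy⟩, htS⟩
  rw [piMap, piMap, this]

theorem continuous_piMap (S : Set ℝ) : Continuous (piMap S) := by
  refine (LipschitzWith.of_dist_le_mul (K := 1) fun x y => ?_).continuous
  rw [NNReal.coe_one, one_mul, Real.dist_eq, Real.dist_eq]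
  rcases le_total x y with h | h
  · rw [abs_sub_comm, abs_sub_comm x y, abs_of_nonneg (sub_nonneg.2 (piMap_mono S h)),
      abs_of_nonneg (sub_nonneg.2 h)]
    linarith [piMap_le_add S h]
  · rw [abs_of_nonneg (sub_nonneg.2 (piMap_mono S h)), abs_of_nonneg (sub_nonneg.2 h)]
    linarith [piMap_le_add S h]

theorem piInv_nonneg (R : ℝ) (S : Set ℝ) (y : ℝ) : 0 ≤ piInv R S y :=
  Real.sInf_nonneg fun _ hx => hx.1.1

theorem piInv_spec (hR : 0 ≤ R) {y : ℝ} (h0 : 0 ≤ y) (hy : y ≤ piMap S R) :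
    piInv R S y ∈ Set.Icc 0 R ∧ piMap S (piInv R S y) = y := by
  have hc : IsClosed {x | x ∈ Set.Icc 0 R ∧ piMap S x = y} :=
    isClosed_Icc.inter (isClosed_eq (continuous_piMap S) continuous_const)
  have hne : {x | x ∈ Set.Icc 0 R ∧ piMap S x = y}.Nonempty := by
    have := intermediate_value_Icc hR (continuous_piMap S).continuousOn
    obtain ⟨x, hx, hxy⟩ := this ⟨(piMap_of_nonpos S le_rfl).symm ▸ h0, hy⟩
    exact ⟨x, hx, hxy⟩
  exact hc.csInf_mem hne ⟨0, fun x hx => hx.1.1⟩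

theorem piInv_le (hR : 0 ≤ R) {y s : ℝ} (h0 : 0 < y) (hy : y ≤ piMap S R)
    (hs : y ≤ piMap S s) : piInv R S y ≤ s := by
  obtain ⟨h1, h2⟩ := piInv_spec hR h0.le hy
  by_contra hlt
  push Not at hlt
  -- This needs `y > 0`: for `y = 0` a negative `s` would satisfy the hypothesis, while `piInv` is
  -- never negative.
  have hs0 : 0 ≤ s := by
    by_contra hneg
    rw [piMap_of_nonpos S (not_le.1 hneg).le] at hs
    linarith
  have h3 : piMap S s = y := le_antisymm (h2 ▸ piMap_mono S hlt.le) hs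
  have : piInv R S y ≤ s :=
    csInf_le ⟨0, fun x hx => hx.1.1⟩ ⟨⟨hs0, hlt.le.trans h1.2⟩, h3⟩
  linarith

theorem le_piMap_of_piInv_le (hR : 0 ≤ R) {y s : ℝ} (h0 : 0 ≤ y) (hy : y ≤ piMap S R)
    (hs : piInv R S y ≤ s) : y ≤ piMap S s :=
  (piInv_spec hR h0 hy).2.symm.le.trans (piMap_mono S hs)

theorem piMap_le_of_le_piInv (hR : 0 ≤ R) {y s : ℝ} (h0 : 0 ≤ y) (hy : y ≤ piMap S R)
    (hs : s ≤ piInv R S y) : piMap S s ≤ y :=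
  (piMap_mono S hs).trans (piInv_spec hR h0 hy).2.le

theorem lt_piInv_of_piMap_lt (hR : 0 ≤ R) {y s : ℝ} (h0 : 0 ≤ y) (hy : y ≤ piMap S R)
    (hs : piMap S s < y) : s < piInv R S y := by
  by_contra h
  exact absurd (le_piMap_of_piInv_le hR h0 hy (not_lt.1 h)) (not_le.2 hs)

/-- Outside the range of `piMap S` on `[0, R]` the infimum of the empty set gives the value 0, so
`piInv` is not monotone on the line. For `c > 0`, however, the set where it is at least `c` lies in
`(0, piMap S R]`, where it is monotone, and is thus order connected. -/
theorem measurable_piInv (hR : 0 ≤ R) (S : Set ℝ) : Measurable (piInv R S) := by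
  refine measurable_of_Ici fun c => ?_
  rcases le_or_gt c 0 with hc | hc
  · have : piInv R S ⁻¹' Set.Ici c = Set.univ :=
      Set.eq_univ_of_forall fun y => hc.trans (piInv_nonneg R S y)
    rw [this]
    exact MeasurableSet.univ
  have hmem : ∀ y ∈ piInv R S ⁻¹' Set.Ici c, 0 < y ∧ y ≤ piMap S R := by
    intro y hy
    have hne : {x | x ∈ Set.Icc 0 R ∧ piMap S x = y}.Nonempty := by
      by_contra hne
      rw [Set.not_nonempty_iff_eq_empty] at hne
      have : piInv R S y = 0 := by rw [piInv, hne, Real.sInf_empty]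
      have hy' : c ≤ piInv R S y := hy
      linarith
    obtain ⟨x, hx, rfl⟩ := hne
    refine ⟨?_, piMap_mono S hx.2⟩
    by_contra hn
    have h0 : piMap S x = 0 := le_antisymm (not_lt.1 hn) ENNReal.toReal_nonneg
    have : piInv R S (piMap S x) ≤ 0 := by
      refine csInf_le ⟨0, fun x hx => hx.1.1⟩ ⟨⟨le_rfl, hR⟩, ?_⟩
      rw [h0, piMap_of_nonpos S le_rfl]
    have hy' : c ≤ piInv R S (piMap S x) := hy
    linarith
  refine Set.OrdConnected.measurableSet ⟨fun y hy z hz w hw => ?_⟩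
  have h1 := hmem y hy
  have h2 := hmem z hz
  have hw1 : w ≤ piMap S R := hw.2.trans h2.2
  have hw0 : 0 < w := h1.1.trans_le hw.1
  have : piInv R S y ≤ piInv R S w :=
    piInv_le hR h1.1 h1.2 (by rw [(piInv_spec hR hw0.le hw1).2]; exact hw.1)
  exact le_trans hy this

end RadiusMap

/-! ### An averaging bound for monotone functions. -/

section Growth

/-- A monotone function rarely grows fast at the scale `r`. -/
theorem measure_fast_growth_le {f : ℝ → ℝ} (hf : Monotone f) {r c lo hi : ℝ} (hr : 0 < r)
    (hlo : lo ≤ hi) :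
    c * volume.real {s | s ∈ Set.Ioc lo hi ∧ c ≤ f (s + r) - f s} ≤ r * (f (hi + r) - f lo) := by
  have hf' : Monotone fun s => f (s + r) := fun a b hab => hf (by linarith)
  have i1 : ∀ a b, IntervalIntegrable f volume a b := fun a b => hf.intervalIntegrable
  have i2 : IntervalIntegrable (fun s => f (s + r)) volume lo hi := hf'.intervalIntegrable
  have hint : Integrable (fun s => f (s + r) - f s) (volume.restrict (Set.Ioc lo hi)) :=
    (intervalIntegrable_iff_integrableOn_Ioc_of_le hlo).1 (i2.sub (i1 lo hi))
  have hmk := mul_meas_ge_le_integral_of_nonneg (μ := volume.restrict (Set.Ioc lo hi))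
    (f := fun s => f (s + r) - f s)
    (Filter.Eventually.of_forall fun s => sub_nonneg.2 (hf (by linarith))) hint c
  have hset : (volume.restrict (Set.Ioc lo hi)).real {s | c ≤ f (s + r) - f s} =
      volume.real {s | s ∈ Set.Ioc lo hi ∧ c ≤ f (s + r) - f s} := by
    rw [Measure.real, Measure.restrict_apply' measurableSet_Ioc, Measure.real, Set.inter_comm]
    rfl
  -- In the Markov bound the integral of `f (s + r) - f s` telescopes to the integrals of `f` over
  -- the two end pieces, each of length `r`.
  rw [hset, ← intervalIntegral.integral_of_le hlo, intervalIntegral.integral_sub i2 (i1 lo hi),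
    intervalIntegral.integral_comp_add_right,
    intervalIntegral.integral_interval_sub_interval_comm (i1 _ _) (i1 _ _) (i1 _ _)] at hmk
  have b1 : ∫ x in (lo + r)..lo, f x = -∫ x in lo..(lo + r), f x :=
    intervalIntegral.integral_symm _ _
  have b1' : ∫ x in (hi + r)..hi, f x = -∫ x in hi..(hi + r), f x :=
    intervalIntegral.integral_symm _ _
  have b2 : (∫ _ in lo..(lo + r), f lo) ≤ ∫ x in lo..(lo + r), f x :=
    intervalIntegral.integral_mono_on (by linarith) (by simp) (i1 _ _) fun x hx => hf hx.1
  have b3 : (∫ x in hi..(hi + r), f x) ≤ ∫ _ in hi..(hi + r), f (hi + r) :=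
    intervalIntegral.integral_mono_on (by linarith) (i1 _ _) (by simp) fun x hx => hf hx.2
  simp only [intervalIntegral.integral_const, add_sub_cancel_left, smul_eq_mul] at b2 b3
  linarith

end Growth

/-- `d` is a pseudometric. -/
structure IsPseudometric {V : Type*} (d : V → V → ℝ) : Prop where
  self : ∀ u, d u u = 0
  symm : ∀ u v, d u v = d v u
  triangle : ∀ u v w, d u w ≤ d u v + d v w

theorem IsPseudometric.nonneg {V : Type*} {d : V → V → ℝ} (hd : IsPseudometric d) (u v : V) :
    0 ≤ d u v := by
  have h1 := hd.triangle u v u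
  rw [hd.self, hd.symm v u] at h1
  linarith

/-! ### Balls around the pivot and the abundance of good radii. -/

section Geometry

variable {V : Type*} {d : V → V → ℝ} {p : Params} {Y : Finset V} {z u : V}

theorem mem_ball {l : ℝ} {v : V} : v ∈ ball d Y u l ↔ v ∈ Y ∧ d u v ≤ l := by
  simp [ball]

theorem ball_subset (d : V → V → ℝ) (Y : Finset V) (u : V) (l : ℝ) : ball d Y u l ⊆ Y :=
  fun _ hv => (mem_ball.1 hv).1

theorem ball_mono (d : V → V → ℝ) (Y : Finset V) (u : V) : Monotone (ball d Y u) :=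
  fun _ _ hst _ hv => mem_ball.2 ⟨(mem_ball.1 hv).1, (mem_ball.1 hv).2.trans hst⟩

theorem cut_nonneg (P : Finset V) (u v : V) : 0 ≤ cut P u v := by
  unfold cut; split_ifs <;> norm_num

theorem cut_le_one (P : Finset V) (u v : V) : cut P u v ≤ 1 := by
  unfold cut; split_ifs <;> norm_num

theorem touch_nonneg (P : Finset V) (u v : V) : 0 ≤ touch P u v := by
  unfold touch; split_ifs <;> norm_num

theorem cut_le_touch (P : Finset V) (u v : V) : cut P u v ≤ touch P u v := by
  unfold touch cut
  split_ifs with h1 h2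
  · exact le_rfl
  · exact absurd (h1.imp And.left And.right) h2
  · exact zero_le_one
  · exact le_rfl

theorem touch_eq_one_right {P : Finset V} {v : V} (u : V) (hv : v ∈ P) : touch P u v = 1 := by
  simp [touch, hv]

theorem touch_eq_one_left {P : Finset V} {u : V} (v : V) (hu : u ∈ P) : touch P u v = 1 := by
  simp [touch, hu]

/-- A set around `z` is spread out when seen from a point `u` that is not very close to `z`. -/
theorem mass_le (hd : IsPseudometric d) (hR₀ : 0 < p.R₀)
    (hz : ∀ u ∈ Y, (ball d Y u p.R₀).card ≤ (ball d Y z p.R₀).card) (hu : u ∈ Y)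
    (hzu : 2 * p.R₀ ≤ d z u) {s : ℝ} (hs : p.R₀ ≤ s) :
    p.R₀ / 2 * ((ball d Y z s).card : ℝ) ≤ ∑ v ∈ ball d Y z s, d u v := by
  classical
  have key : ∀ A ⊆ ball d Y z s, (∀ v ∈ A, p.R₀ ≤ d u v) →
      (A.card : ℝ) * p.R₀ ≤ ∑ v ∈ ball d Y z s, d u v := by
    intro A hA hAd
    calc (A.card : ℝ) * p.R₀ = ∑ v ∈ A, p.R₀ := by simp
      _ ≤ ∑ v ∈ A, d u v := Finset.sum_le_sum hAd
      _ ≤ _ := Finset.sum_le_sum_of_subset_of_nonneg hA fun v _ _ => hd.nonneg u v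
  -- Two sets are at distance at least `R₀` from `u`: `Ball(z, R₀)` and `Ball(z, s)` without
  -- `Ball(u, R₀)`. By maximality the first is at least as large as what the second omits, so their
  -- sizes add up to at least `|Ball(z, s)|`; since they may overlap, half is lost.
  have h1 := key (ball d Y z p.R₀) (ball_mono d Y z hs) (fun v hv => by
    have := hd.triangle z v u
    rw [hd.symm v u] at this
    linarith [(mem_ball.1 hv).2])
  have h2 := key (ball d Y z s \ ball d Y u p.R₀) Finset.sdiff_subset (fun v hv => by
    rw [Finset.mem_sdiff] at hv
    by_contra hlt
    exact hv.2 (mem_ball.2 ⟨(mem_ball.1 hv.1).1, (not_le.1 hlt).le⟩))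
  have h3 : (ball d Y z s).card ≤
      (ball d Y z s \ ball d Y u p.R₀).card + (ball d Y z p.R₀).card :=
    (Finset.card_le_card_sdiff_add_card).trans (Nat.add_le_add_left (hz u hu) _)
  have h4 : ((ball d Y z s).card : ℝ) ≤
      ((ball d Y z s \ ball d Y u p.R₀).card : ℝ) + ((ball d Y z p.R₀).card : ℝ) := by
    exact_mod_cast h3
  nlinarith

/-- The condition that defines the good radii. -/
def IsGoodCluster (d : V → V → ℝ) (p : Params) (Y Q : Finset V) : Prop :=
  ∀ u ∈ Y, ∑ v ∈ ball d Y u p.r, cut Q u v ≤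
    25 * p.β * p.D ^ 2 * ∑ v ∈ ball d Y u (2 * p.R), d u v / p.R * touch Q u v

theorem goodRadii_eq (d : V → V → ℝ) (p : Params) (Y : Finset V) (z : V) :
    goodRadii d p Y z =
      {s | s ∈ Set.Ioc (3 * p.R₀) p.R₁ ∧ IsGoodCluster d p Y (ball d Y z s)} := rfl

/-- The set `S` need not be closed, so the minimal preimage can fall outside it. Between two radii
with the same bad cluster `piMap S` is constant. As there are finitely many clusters, the bad radii
in `(lo, hi]` have only finitely many images, which the atomless law misses. -/
theorem piInv_mem_ae [Finite V] (hp : p.Tame) {N : ℝ → Finset V} (hN : Monotone N)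
    (Good : Finset V → Prop) {lo hi : ℝ} {S : Set ℝ}
    (hS : S = {s | s ∈ Set.Ioc lo hi ∧ Good (N s)})
    (hvol : p.R / 2 ≤ piMap S p.R) :
    ∀ᵐ x ∂p.radiusLaw, piInv p.R S x ∈ S := by
  have := Params.Tame.nullSingletonClass_radiusLaw p
  set E : Set ℝ := ⋃ T : Finset V, piMap S '' {s | s ∈ Set.Ioc lo hi ∧ N s = T ∧ ¬ Good T}
    with hE
  have hEfin : E.Finite := by
    refine Set.finite_iUnion fun T => Set.Subsingleton.finite ?_
    have aux : ∀ s t : ℝ, s ≤ t → s ∈ Set.Ioc lo hi → t ∈ Set.Ioc lo hi → N s = T → N t = T →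
        ¬ Good T → piMap S t = piMap S s := by
      intro s t hst _ _ hsT htT hT
      refine piMap_eq_of_disjoint hst fun w hw hwS => hT ?_
      rw [hS] at hwS
      have : N w = T := le_antisymm (htT ▸ hN hw.2) (hsT ▸ hN hw.1.le)
      exact this ▸ hwS.2
    rintro _ ⟨s, ⟨hs, hsT, hT⟩, rfl⟩ _ ⟨t, ⟨ht, htT, -⟩, rfl⟩
    rcases le_total s t with h | h
    · exact (aux s t h hs ht hsT htT hT).symm
    · exact aux t s h ht hs htT hsT hT
  have hEae : ∀ᵐ x ∂p.radiusLaw, x ∉ E := measure_eq_zero_iff_ae_notMem.1 (hEfin.measure_zero _)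
  filter_upwards [hEae, hp.ae_mem_Ioc] with x hxE hx
  have hR := hp.R_pos
  have hxR : x ≤ piMap S p.R := hx.2.trans hvol
  obtain ⟨ht, hπ⟩ := piInv_spec hR.le hx.1.le hxR
  set t := piInv p.R S x with htdef
  have h1 : lo < t := by
    by_contra hle
    have : piMap S t = piMap S 0 := piMap_eq_of_disjoint ht.1 fun w hw hwS => by
      rw [hS] at hwS
      linarith [hwS.1.1, hw.2]
    rw [piMap_of_nonpos S le_rfl] at this
    linarith [hx.1]
  have h2 : t ≤ hi := by
    by_contra hlt
    have : piMap S t = piMap S hi := piMap_eq_of_disjoint (not_le.1 hlt).le fun w hw hwS => by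
      rw [hS] at hwS
      linarith [hwS.1.2, hw.1]
    exact hlt (piInv_le hR.le hx.1 hxR (by rw [← this, hπ]))
  rw [hS]
  refine ⟨⟨h1, h2⟩, ?_⟩
  by_contra hbad
  exact hxE (Set.mem_iUnion.2 ⟨N t, t, ⟨⟨h1, h2⟩, rfl, hbad⟩, hπ⟩)

/-- Around a bad radius the size of the ball grows fast. -/
theorem fast_growth_of_not_good (hp : p.Tame) (hd : IsPseudometric d)
    (hz : ∀ u ∈ Y, (ball d Y u p.R₀).card ≤ (ball d Y z p.R₀).card) {s : ℝ}
    (hs : s ∈ Set.Ioc (3 * p.R₀) p.R₁) (hbad : ¬ IsGoodCluster d p Y (ball d Y z s)) :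
    (1 + 25 / 2 * p.β * p.D) * ((ball d Y z s).card : ℝ) ≤ ((ball d Y z (s + p.r)).card : ℝ) ∨
    (1 + 25 / 2 * p.β * p.D) * ((ball d Y z (s - p.r)).card : ℝ) ≤
      ((ball d Y z s).card : ℝ) := by
  classical
  have hR₀ := hp.R₀_pos
  have hr := hp.r_pos
  have hrR := hp.r_le
  have hR := hp.R_pos
  have hβ := hp.β_pos
  have hD := hp.D_pos
  have hR₁ : p.R₁ = p.R - p.R₀ := rfl
  unfold IsGoodCluster at hbad
  push Not at hbad
  obtain ⟨u, hu, hlt⟩ := hbad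
  set Q := ball d Y z s with hQ
  have hs1 := hs.1
  have hs2 := hs.2
  -- The violated inequality has a nonnegative right side, so some pair `u, v₀` of length at most
  -- `r` is cut, and `u` lies within `r` of the sphere of radius `s`.
  have hpos : 0 < ∑ v ∈ ball d Y u p.r, cut Q u v := by
    refine lt_of_le_of_lt (mul_nonneg (by positivity) (Finset.sum_nonneg fun v _ => ?_)) hlt
    exact mul_nonneg (div_nonneg (hd.nonneg u v) hR.le) (touch_nonneg _ _ _)
  obtain ⟨v₀, hv₀, hcut₀⟩ : ∃ v ∈ ball d Y u p.r, 0 < cut Q u v := by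
    by_contra! hno
    linarith [Finset.sum_nonpos hno]
  have hv₀' := mem_ball.1 hv₀
  -- the mass of `Q` seen from `u`
  have lower : 2 * p.R₀ ≤ d z u → d z u ≤ p.R →
      25 / 2 * p.β * p.D * (Q.card : ℝ) < ∑ v ∈ ball d Y u p.r, cut Q u v := by
    intro h1 h2
    refine lt_of_le_of_lt ?_ hlt
    have hm := mass_le hd hR₀ hz hu h1 (s := s) (by linarith)
    have hsub : Q ⊆ ball d Y u (2 * p.R) := fun v hv => by
      have := hd.triangle u z v
      rw [hd.symm u z] at this
      exact mem_ball.2 ⟨(mem_ball.1 hv).1, by linarith [(mem_ball.1 hv).2]⟩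
    have hsum : (∑ v ∈ Q, d u v) / p.R ≤
        ∑ v ∈ ball d Y u (2 * p.R), d u v / p.R * touch Q u v := by
      rw [Finset.sum_div]
      calc ∑ v ∈ Q, d u v / p.R = ∑ v ∈ Q, d u v / p.R * touch Q u v :=
            Finset.sum_congr rfl fun v hv => by rw [touch_eq_one_right u hv, mul_one]
        _ ≤ _ := Finset.sum_le_sum_of_subset_of_nonneg hsub fun v _ _ =>
            mul_nonneg (div_nonneg (hd.nonneg u v) hR.le) (touch_nonneg _ _ _)
    calc 25 / 2 * p.β * p.D * (Q.card : ℝ)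
        = 25 * p.β * p.D ^ 2 * (p.R₀ / 2 * (Q.card : ℝ) / p.R) := by
          rw [← hp.R₀_mul_D]; field_simp
      _ ≤ _ := by
          refine mul_le_mul_of_nonneg_left ?_ (by positivity)
          exact (div_le_div_of_nonneg_right hm hR.le).trans hsum
  -- A cut partner of `u` lies just outside `Q` if `u` is inside, and just inside otherwise; this
  -- decides on which side of `s` the growth occurs.
  by_cases huQ : u ∈ Q
  · left
    have hv₀Q : v₀ ∉ Q := fun h => by simp [cut, huQ, h] at hcut₀
    have hdv : s < d z v₀ := by
      by_contra h
      exact hv₀Q (mem_ball.2 ⟨hv₀'.1, not_lt.1 h⟩)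
    -- Good radii start at `3 * R₀` so that `s - r ≥ 2 * R₀` here.
    have hlow : 2 * p.R₀ ≤ d z u := by linarith [hd.triangle z u v₀]
    have hzu := (mem_ball.1 huQ).2
    have hL := lower hlow (by linarith)
    have hcount : ∑ v ∈ ball d Y u p.r, cut Q u v ≤
        ((ball d Y z (s + p.r) \ Q).card : ℝ) := by
      calc ∑ v ∈ ball d Y u p.r, cut Q u v
          ≤ ∑ v ∈ ball d Y u p.r, if v ∈ ball d Y z (s + p.r) \ Q then (1 : ℝ) else 0 := by
            refine Finset.sum_le_sum fun v hv => ?_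
            have hv := mem_ball.1 hv
            by_cases hvQ : v ∈ Q
            · simp [cut, huQ, hvQ]
            · have : v ∈ ball d Y z (s + p.r) :=
                mem_ball.2 ⟨hv.1, by linarith [hd.triangle z u v]⟩
              simp [hvQ, this, cut_le_one]
        _ ≤ _ := by
            rw [Finset.sum_boole]
            exact_mod_cast Finset.card_le_card fun v hv => (Finset.mem_filter.1 hv).2
    have hc : ((ball d Y z (s + p.r) \ Q).card : ℝ) + (Q.card : ℝ) =
        ((ball d Y z (s + p.r)).card : ℝ) := by
      exact_mod_cast Finset.card_sdiff_add_card_eq_card (ball_mono d Y z (by linarith))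
    nlinarith
  · right
    have hv₀Q : v₀ ∈ Q := by
      by_contra h
      simp [cut, huQ, h] at hcut₀
    have hdu : s < d z u := by
      by_contra h
      exact huQ (mem_ball.2 ⟨hu, not_lt.1 h⟩)
    have hup : d z u ≤ p.R := by
      have := hd.triangle z v₀ u
      rw [hd.symm v₀ u] at this
      linarith [(mem_ball.1 hv₀Q).2]
    have hL := lower (by linarith) hup
    have hcount : ∑ v ∈ ball d Y u p.r, cut Q u v ≤
        ((Q \ ball d Y z (s - p.r)).card : ℝ) := by
      calc ∑ v ∈ ball d Y u p.r, cut Q u v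
          ≤ ∑ v ∈ ball d Y u p.r, if v ∈ Q \ ball d Y z (s - p.r) then (1 : ℝ) else 0 := by
            refine Finset.sum_le_sum fun v hv => ?_
            have hv := mem_ball.1 hv
            by_cases hvQ : v ∈ Q
            · have : v ∉ ball d Y z (s - p.r) := fun h => by
                have h1 := hd.triangle z v u
                rw [hd.symm v u] at h1
                linarith [(mem_ball.1 h).2]
              simp [hvQ, this, cut_le_one]
            · simp [cut, huQ, hvQ]
        _ ≤ _ := by
            rw [Finset.sum_boole]
            exact_mod_cast Finset.card_le_card fun v hv => (Finset.mem_filter.1 hv).2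
    have hsub : ball d Y z (s - p.r) ⊆ Q := ball_mono d Y z (by linarith)
    have hc : ((Q \ ball d Y z (s - p.r)).card : ℝ) + ((ball d Y z (s - p.r)).card : ℝ) =
        (Q.card : ℝ) := by
      exact_mod_cast Finset.card_sdiff_add_card_eq_card hsub
    have hle : ((ball d Y z (s - p.r)).card : ℝ) ≤ (Q.card : ℝ) := by
      exact_mod_cast Finset.card_le_card hsub
    have : 0 ≤ 25 / 2 * p.β * p.D := by positivity
    nlinarith

/-- If the large ball around the pivot is light, then at least half of all radii are good. -/
theorem half_le_piMap_goodRadii (hp : p.Tame) (hd : IsPseudometric d) (hzY : z ∈ Y)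
    (hz : ∀ u ∈ Y, (ball d Y u p.R₀).card ≤ (ball d Y z p.R₀).card)
    (hlight : ((ball d Y z p.R₁).card : ℝ) < p.ρ * ((ball d Y z p.R₀).card : ℝ)) :
    p.R / 2 ≤ piMap (goodRadii d p Y z) p.R := by
  have hR₀ := hp.R₀_pos
  have hr := hp.r_pos
  have hrR := hp.r_le
  have hR := hp.R_pos
  have hβ := hp.β_pos
  have hD := hp.D_pos
  have hDR := hp.R₀_le
  have hR₁ : p.R₁ = p.R - p.R₀ := rfl
  set η := 25 / 2 * p.β * p.D with hη
  have hη0 : 0 < η := by positivity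
  have hη1 : η ≤ 1 := by linarith [hp.small]
  -- For negative radii the ball is empty, and `Real.log 0 = 0` keeps `f` monotone.
  set f : ℝ → ℝ := fun s => Real.log ((ball d Y z s).card : ℝ) with hf
  have hcard1 : ∀ s, 0 ≤ s → (1 : ℝ) ≤ ((ball d Y z s).card : ℝ) := fun s hs => by
    have : z ∈ ball d Y z s := mem_ball.2 ⟨hzY, by rwa [hd.self]⟩
    exact_mod_cast Finset.card_pos.2 ⟨z, this⟩
  have hfm : Monotone f := fun s t hst => by
    have hle : (ball d Y z s).card ≤ (ball d Y z t).card := Finset.card_le_card (ball_mono d Y z hst)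
    rcases Nat.eq_zero_or_pos (ball d Y z s).card with h0 | h0
    · simp only [hf, h0, Nat.cast_zero, Real.log_zero]
      exact Real.log_natCast_nonneg _
    · exact Real.log_le_log (by exact_mod_cast h0) (by exact_mod_cast hle)
  have hgrow : ∀ s t, 0 ≤ s → (1 + η) * ((ball d Y z s).card : ℝ) ≤ ((ball d Y z t).card : ℝ) →
      η / 2 ≤ f t - f s := by
    intro s t hs h
    have h1 := hcard1 s hs
    have h2 : Real.log (1 + η) + f s ≤ f t := by
      rw [hf, ← Real.log_mul (by linarith) (by linarith)]
      exact Real.log_le_log (by positivity) h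
    have h3 := Real.one_sub_inv_le_log_of_pos (x := 1 + η) (by linarith)
    have h4 : η / 2 ≤ 1 - (1 + η)⁻¹ := by
      have : 1 - (1 + η)⁻¹ = η / (1 + η) := by field_simp; ring
      rw [this]
      exact div_le_div_of_nonneg_left hη0.le (by linarith) (by linarith)
    linarith
  set S := goodRadii d p Y z with hS
  set B := {s | s ∈ Set.Ioc (2 * p.R₀) (p.R₁ - p.r) ∧ η / 2 ≤ f (s + p.r) - f s} with hB
  -- The total growth of `f` on `[R₀, R₁]` is at most `D / 2`, and each point of `B` sees growth
  -- `25/4 * β * D` within `r = β * R`. Stopping `B` at `R₁ - r` keeps `s + r` where the ball size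
  -- is controlled.
  have hBvol : volume.real B ≤ 2 / 25 * p.R := by
    have h1 := measure_fast_growth_le hfm (c := η / 2) (lo := 2 * p.R₀) (hi := p.R₁ - p.r) hr
      (by linarith)
    have h2 : f (p.R₁ - p.r + p.r) - f (2 * p.R₀) ≤ p.D / 2 := by
      have e : f p.R₁ ≤ Real.log p.ρ + f p.R₀ := by
        rw [hf, ← Real.log_mul hp.ρ_pos.ne' (by linarith [hcard1 p.R₀ hR₀.le])]
        exact Real.log_le_log (by linarith [hcard1 p.R₁ (by linarith)]) hlight.le
      rw [hp.ρ_eq, Real.log_exp] at e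
      rw [sub_add_cancel]
      linarith [hfm (show p.R₀ ≤ 2 * p.R₀ by linarith)]
    have h3 : η / 2 * volume.real B ≤ p.r * (p.D / 2) :=
      h1.trans (mul_le_mul_of_nonneg_left h2 hr.le)
    rw [← hp.R_eq_β] at h3
    have h4 : p.β * p.D * (25 / 4 * volume.real B) ≤ p.β * p.D * (p.R / 2) := by
      rw [hη] at h3; linarith
    have := le_of_mul_le_mul_left h4 (by positivity)
    linarith
  have hcover : Set.Ioc (3 * p.R₀) p.R₁ ⊆
      (Set.Icc 0 p.R ∩ S) ∪ (B ∪ ((fun s => s + -p.r) ⁻¹' B ∪ Set.Icc (p.R₁ - p.r) p.R₁)) := by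
    intro s hs
    by_cases hg : s ∈ S
    · exact Or.inl ⟨⟨by linarith [hs.1], by linarith [hs.2]⟩, hg⟩
    right
    rcases le_or_gt (p.R₁ - p.r) s with h1 | h1
    · exact Or.inr (Or.inr ⟨h1, hs.2⟩)
    rw [hS, goodRadii_eq] at hg
    have hbad : ¬ IsGoodCluster d p Y (ball d Y z s) := fun h => hg ⟨hs, h⟩
    have hs1 := hs.1
    rcases fast_growth_of_not_good hp hd hz hs hbad with h | h
    · exact Or.inl ⟨⟨by linarith, h1.le⟩, hgrow _ _ (by linarith) h⟩
    · refine Or.inr (Or.inl ⟨⟨?_, ?_⟩, ?_⟩)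
      · change 2 * p.R₀ < s + -p.r
        linarith
      · change s + -p.r ≤ p.R₁ - p.r
        linarith
      · change η / 2 ≤ f (s + -p.r + p.r) - f (s + -p.r)
        rw [neg_add_cancel_right, ← sub_eq_add_neg]
        exact hgrow _ _ (by linarith) h
  have hBfin : volume B ≠ ⊤ :=
    ((measure_mono (fun s hs => hs.1 : B ⊆ Set.Ioc (2 * p.R₀) (p.R₁ - p.r))).trans_lt
      (by simp)).ne
  have hshift : volume ((fun s => s + -p.r) ⁻¹' B) = volume B :=
    measure_preimage_add_right volume (-p.r) B
  have hfin : volume (B ∪ ((fun s => s + -p.r) ⁻¹' B ∪ Set.Icc (p.R₁ - p.r) p.R₁)) ≠ ⊤ := by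
    refine measure_union_ne_top hBfin (measure_union_ne_top (by rwa [hshift]) (by simp))
  have h1 : volume.real (Set.Ioc (3 * p.R₀) p.R₁) ≤ _ :=
    measureReal_mono hcover (measure_union_ne_top (volume_Icc_inter_ne_top S p.R) hfin)
  have h2 := measureReal_union_le (μ := volume) (Set.Icc 0 p.R ∩ S)
    (B ∪ ((fun s => s + -p.r) ⁻¹' B ∪ Set.Icc (p.R₁ - p.r) p.R₁))
  have h3 := measureReal_union_le (μ := volume) B
    ((fun s => s + -p.r) ⁻¹' B ∪ Set.Icc (p.R₁ - p.r) p.R₁)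
  have h4 := measureReal_union_le (μ := volume) ((fun s => s + -p.r) ⁻¹' B)
    (Set.Icc (p.R₁ - p.r) p.R₁)
  have h5 : volume.real ((fun s => s + -p.r) ⁻¹' B) = volume.real B := by
    rw [Measure.real, hshift, Measure.real]
  have h6 : volume.real (Set.Icc (p.R₁ - p.r) p.R₁) = p.r := by
    rw [Real.volume_real_Icc_of_le (by linarith)]; ring
  have h7 : volume.real (Set.Ioc (3 * p.R₀) p.R₁) = p.R₁ - 3 * p.R₀ :=
    Real.volume_real_Ioc_of_le (by linarith)
  have h8 : piMap S p.R = volume.real (Set.Icc 0 p.R ∩ S) := rfl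
  rw [h8]
  -- The good radii keep at least `R - 4 * R₀ - r - 4/25 * R`, and `r ≤ R₀ ≤ R / 20`.
  linarith

end Geometry

/-! ### Charging the pairs cut in a single step. -/

/-- The requirements on the cut weights `W` and the payments `ℓ` of the pairs that contain `u`. -/
structure IsCharging {V : Type*} (d : V → V → ℝ) (p : Params) (u : V) (W ℓ : V → ℝ) (σ κ : ℝ) :
    Prop where
  W_nonneg : ∀ v, 0 ≤ W v
  W_le : ∀ v, W v ≤ σ
  W_mul_le : ∀ v, W v * d u v ≤ ℓ v
  κ_pos : 0 < κ
  κ_mul_le : ∀ v, d u v ≤ 2 * p.R → κ * d u v ≤ ℓ v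
  ℓ_nonneg : ∀ v, 0 ≤ ℓ v

section Step

variable {V : Type*} {d : V → V → ℝ} {p : Params} {Y : Finset V} {z u : V} {W ℓ : V → ℝ}
  {σ κ : ℝ}

theorem IsCharging.σ_nonneg (hc : IsCharging d p u W ℓ σ κ) : 0 ≤ σ :=
  (hc.W_nonneg u).trans (hc.W_le u)

theorem IsCharging.pay_nonneg (hc : IsCharging d p u W ℓ σ κ) (Y P : Finset V) :
    0 ≤ ∑ v ∈ Y, ℓ v * touch P u v :=
  Finset.sum_nonneg fun v _ => mul_nonneg (hc.ℓ_nonneg v) (touch_nonneg _ _ _)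

theorem IsCharging.W_le_of_far (hc : IsCharging d p u W ℓ σ κ) {s : ℝ} (hs : 0 < s) {v : V}
    (hv : s ≤ d u v) : W v ≤ 1 / s * ℓ v := by
  rw [one_div, inv_mul_eq_div, le_div_iff₀ hs]
  exact (mul_le_mul_of_nonneg_left hv (hc.W_nonneg v)).trans (hc.W_mul_le v)

/-- Far pairs pay for themselves, near pairs are counted. -/
theorem IsCharging.cut_sum_le (hc : IsCharging d p u W ℓ σ κ) (P : Finset V) {s : ℝ} (hs : 0 < s) :
    ∑ v ∈ Y, W v * cut P u v ≤
      1 / s * ∑ v ∈ Y, ℓ v * touch P u v + σ * ∑ v ∈ ball d Y u s, cut P u v := by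
  classical
  have hball : ball d Y u s = Y.filter fun v => d u v ≤ s := by
    ext v; simp [mem_ball]
  rw [hball, Finset.sum_filter, Finset.mul_sum, Finset.mul_sum, ← Finset.sum_add_distrib]
  refine Finset.sum_le_sum fun v _ => ?_
  have h1 : 0 ≤ 1 / s * (ℓ v * touch P u v) :=
    mul_nonneg (by positivity) (mul_nonneg (hc.ℓ_nonneg v) (touch_nonneg _ _ _))
  split_ifs with h
  · have := mul_le_mul_of_nonneg_right (hc.W_le v) (cut_nonneg P u v)
    linarith
  · have h2 := hc.W_le_of_far hs (not_le.1 h).le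
    have h3 := mul_le_mul h2 (cut_le_touch P u v) (cut_nonneg P u v)
      (mul_nonneg (by positivity) (hc.ℓ_nonneg v))
    linarith

/-- Pairs longer than `r` pay at rate `1 / r`. The number of shorter cut pairs is bounded by touched
length within `2 * R`, which is exactly the range where `κ * d ≤ ℓ` holds. -/
theorem IsCharging.good_step (hc : IsCharging d p u W ℓ σ κ) (hp : p.Tame)
    {P : Finset V} (hP : IsGoodCluster d p Y P) (hu : u ∈ Y) :
    ∑ v ∈ Y, W v * cut P u v ≤
      (1 / p.r + σ * (25 * p.β * p.D ^ 2 / (p.R * κ))) * ∑ v ∈ Y, ℓ v * touch P u v := by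
  have hR := hp.R_pos
  have hβ := hp.β_pos
  have hD := hp.D_pos
  have hκ := hc.κ_pos
  refine (hc.cut_sum_le P hp.r_pos).trans ?_
  rw [add_mul, mul_assoc σ]
  refine add_le_add le_rfl (mul_le_mul_of_nonneg_left ((hP u hu).trans ?_) hc.σ_nonneg)
  rw [div_mul_eq_mul_div, mul_div_assoc]
  refine mul_le_mul_of_nonneg_left ?_ (by positivity)
  rw [le_div_iff₀ (by positivity), Finset.sum_mul]
  calc ∑ v ∈ ball d Y u (2 * p.R), d u v / p.R * touch P u v * (p.R * κ)
      = ∑ v ∈ ball d Y u (2 * p.R), κ * d u v * touch P u v :=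
        Finset.sum_congr rfl fun v _ => by field_simp
    _ ≤ ∑ v ∈ ball d Y u (2 * p.R), ℓ v * touch P u v := Finset.sum_le_sum fun v hv =>
        mul_le_mul_of_nonneg_right (hc.κ_mul_le v (mem_ball.1 hv).2) (touch_nonneg _ _ _)
    _ ≤ _ := Finset.sum_le_sum_of_subset_of_nonneg (ball_subset _ _ _ _) fun v _ _ =>
        mul_nonneg (hc.ℓ_nonneg v) (touch_nonneg _ _ _)

/-- If `u` lies at an intermediate distance from `z`, then a cluster that contains a ball around
`z` makes `u` pay for the size of this ball. -/
theorem IsCharging.mass_le_pay (hc : IsCharging d p u W ℓ σ κ) (hp : p.Tame)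
    (hd : IsPseudometric d) (hz : ∀ u ∈ Y, (ball d Y u p.R₀).card ≤ (ball d Y z p.R₀).card)
    (hu : u ∈ Y) (h1 : 2 * p.R₀ ≤ d z u) (h2 : d z u ≤ p.R) {s : ℝ} (hs : p.R₀ ≤ s)
    (hsR : s ≤ p.R) {P : Finset V} (hP : ball d Y z s ⊆ P) :
    κ * (p.R₀ / 2 * ((ball d Y z s).card : ℝ)) ≤ ∑ v ∈ Y, ℓ v * touch P u v := by
  have hm := mass_le hd hp.R₀_pos hz hu h1 hs
  calc κ * (p.R₀ / 2 * ((ball d Y z s).card : ℝ)) ≤ κ * ∑ v ∈ ball d Y z s, d u v :=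
        mul_le_mul_of_nonneg_left hm hc.κ_pos.le
    _ = ∑ v ∈ ball d Y z s, κ * d u v := Finset.mul_sum _ _ _
    _ ≤ ∑ v ∈ ball d Y z s, ℓ v * touch P u v := Finset.sum_le_sum fun v hv => by
        rw [touch_eq_one_right u (hP hv), mul_one]
        refine hc.κ_mul_le v ?_
        have := hd.triangle u z v
        rw [hd.symm u z] at this
        linarith [(mem_ball.1 hv).2]
    _ ≤ _ := Finset.sum_le_sum_of_subset_of_nonneg (ball_subset _ _ _ _) fun v _ _ =>
        mul_nonneg (hc.ℓ_nonneg v) (touch_nonneg _ _ _)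

/-- The cut pairs of length at most `R₀` number at most `|Ball(z, R₀)|`, whereas `u` is paid in
proportion to the `ρ` times larger `|Ball(z, R₁)|`. -/
theorem IsCharging.heavy_step (hc : IsCharging d p u W ℓ σ κ) (hp : p.Tame)
    (hd : IsPseudometric d) (hz : ∀ u ∈ Y, (ball d Y u p.R₀).card ≤ (ball d Y z p.R₀).card)
    (hu : u ∈ Y)
    (hheavy : p.ρ * ((ball d Y z p.R₀).card : ℝ) ≤ ((ball d Y z p.R₁).card : ℝ)) :
    ∑ v ∈ Y, W v * cut (ball d Y z p.R₁) u v ≤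
      (1 / p.R₀ + 2 * σ / (κ * p.R₀ * p.ρ)) *
        ∑ v ∈ Y, ℓ v * touch (ball d Y z p.R₁) u v := by
  have hR₀ := hp.R₀_pos
  have hκ := hc.κ_pos
  have hρ := hp.ρ_pos
  have hσ := hc.σ_nonneg
  have hDR := hp.R₀_le
  have hR₁ : p.R₁ = p.R - p.R₀ := rfl
  set P := ball d Y z p.R₁ with hP
  refine (hc.cut_sum_le P hR₀).trans ?_
  rw [add_mul]
  refine add_le_add le_rfl ?_
  have hpay := hc.pay_nonneg Y P
  have e : 2 * σ / (κ * p.R₀ * p.ρ) * ∑ v ∈ Y, ℓ v * touch P u v =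
      σ * (2 / (κ * p.R₀ * p.ρ) * ∑ v ∈ Y, ℓ v * touch P u v) := by ring
  rw [e]
  refine mul_le_mul_of_nonneg_left ?_ hσ
  by_cases hex : ∃ v ∈ ball d Y u p.R₀, 0 < cut P u v
  · obtain ⟨v, hv, hcut⟩ := hex
    have hv := mem_ball.1 hv
    have hrange : 2 * p.R₀ ≤ d z u ∧ d z u ≤ p.R := by
      by_cases huP : u ∈ P
      · have hvP : v ∉ P := fun h => by simp [cut, huP, h] at hcut
        have hdv : p.R₁ < d z v := by
          by_contra h
          exact hvP (mem_ball.2 ⟨hv.1, not_lt.1 h⟩)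
        have := (mem_ball.1 huP).2
        exact ⟨by linarith [hd.triangle z u v], by linarith⟩
      · have hvP : v ∈ P := by
          by_contra h
          simp [cut, huP, h] at hcut
        have hdu : p.R₁ < d z u := by
          by_contra h
          exact huP (mem_ball.2 ⟨hu, not_lt.1 h⟩)
        have h3 := hd.triangle z v u
        rw [hd.symm v u] at h3
        exact ⟨by linarith, by linarith [(mem_ball.1 hvP).2]⟩
    have hm := hc.mass_le_pay hp hd hz hu hrange.1 hrange.2 (s := p.R₁) (by linarith)
      (by linarith) (P := P) le_rfl
    have hcount : ∑ v ∈ ball d Y u p.R₀, cut P u v ≤ ((ball d Y z p.R₀).card : ℝ) := by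
      calc ∑ v ∈ ball d Y u p.R₀, cut P u v ≤ ∑ v ∈ ball d Y u p.R₀, (1 : ℝ) :=
            Finset.sum_le_sum fun v _ => cut_le_one _ _ _
        _ = ((ball d Y u p.R₀).card : ℝ) := by simp
        _ ≤ _ := by exact_mod_cast hz u hu
    refine hcount.trans ?_
    rw [div_mul_eq_mul_div, le_div_iff₀ (by positivity)]
    have h4 := mul_le_mul_of_nonneg_left hheavy (show 0 ≤ κ * p.R₀ by positivity)
    linarith
  · push Not at hex
    exact (Finset.sum_nonpos hex).trans (mul_nonneg (by positivity) hpay)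

theorem measurable_comp_ball [Finite V] (d : V → V → ℝ) (Y : Finset V) (z : V)
    (g : Finset V → ℝ) : Measurable fun s => g (ball d Y z s) := by
  let _ : MeasurableSpace (Finset V) := ⊤
  have : Measurable fun s => ball d Y z s := by
    refine measurable_to_countable' fun T => Set.OrdConnected.measurableSet ⟨?_⟩
    intro s hs t ht w hw
    exact le_antisymm ((ball_mono d Y z hw.2).trans (Set.mem_singleton_iff.1 ht).le)
      ((Set.mem_singleton_iff.1 hs).ge.trans (ball_mono d Y z hw.1))
  exact (measurable_from_top (f := g)).comp this

theorem measurable_comp_clusterSelect [Finite V] (d : V → V → ℝ) {p : Params} (hp : p.Tame)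
    (pivot : Finset V → V) (Y : Finset V) (g : Finset V → ℝ) :
    Measurable fun x => g (clusterSelect d p pivot Y x) := by
  unfold clusterSelect
  split_ifs
  · exact measurable_const
  · exact (measurable_comp_ball d Y (pivot Y) g).comp (measurable_piInv hp.R_pos.le _)

theorem integrable_of_finite_range [Finite V] {Ω : Type*} [MeasurableSpace Ω] {μ : Measure Ω}
    [IsFiniteMeasure μ] {P : Ω → Finset V} {g : Finset V → ℝ}
    (h : Measurable fun x => g (P x)) : Integrable (fun x => g (P x)) μ := by
  obtain ⟨C, hC⟩ := (Set.finite_range fun T => ‖g T‖).bddAbove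
  exact Integrable.of_bound h.aestronglyMeasurable C
    (Filter.Eventually.of_forall fun x => hC ⟨P x, rfl⟩)

section Light

variable [Finite V] {S : Set ℝ}

theorem integrable_comp_ball_piInv (hp : p.Tame) (d : V → V → ℝ) (Y : Finset V) (z : V)
    (S : Set ℝ) (g : Finset V → ℝ) :
    Integrable (fun x => g (ball d Y z (piInv p.R S x))) p.radiusLaw := by
  have := hp.isProbabilityMeasure_radiusLaw
  exact integrable_of_finite_range
    ((measurable_comp_ball d Y z g).comp (measurable_piInv hp.R_pos.le S))

/-- The padding property of the random cluster: a pair is hardly more likely to be cut than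
its length times the probability that it is touched. -/
theorem integral_cut_le (hp : p.Tame) (hd : IsPseudometric d) (hvol : p.R / 2 ≤ piMap S p.R)
    (hu : u ∈ Y) {v : V} (hv : v ∈ Y) :
    ∫ x, cut (ball d Y z (piInv p.R S x)) u v ∂p.radiusLaw ≤
      d u v / p.R₀ *
        ((∫ x, touch (ball d Y z (piInv p.R S x)) u v ∂p.radiusLaw) + 2 / p.ρ) := by
  have := hp.isProbabilityMeasure_radiusLaw
  have hR := hp.R_pos
  set s := min (d z u) (d z v) with hs
  set s' := max (d z u) (d z v) with hs'
  have hss : s ≤ s' := min_le_max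
  have hlen : s' ≤ s + d u v := by
    have h1 := hd.triangle z u v
    have h2 := hd.triangle z v u
    rw [hd.symm v u] at h2
    have h3 := hd.nonneg u v
    rcases le_total (d z u) (d z v) with h | h
    · rw [hs, hs', max_eq_right h, min_eq_left h]; linarith
    · rw [hs, hs', max_eq_left h, min_eq_right h]; linarith
  -- Let `s ≤ s'` be the distances of the pair from `z`. It can be cut only for `x` between `piMap S
  -- s` and `piMap S s'`, and it is touched once `x > piMap S s`. As `piMap` is 1-Lipschitz, the
  -- interval has length at most `d u v` and the padding property applies.
  have hcut : ∫ x, cut (ball d Y z (piInv p.R S x)) u v ∂p.radiusLaw ≤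
      p.radiusLaw.real (Set.Icc (piMap S s) (piMap S s')) := by
    rw [← integral_indicator_one measurableSet_Icc]
    refine integral_mono_ae (integrable_comp_ball_piInv hp d Y z S fun P => cut P u v)
      ((integrable_const (1 : ℝ)).indicator measurableSet_Icc) ?_
    filter_upwards [hp.ae_mem_Ioc] with x hx
    have hxR := hx.2.trans hvol
    by_cases hmem : x ∈ Set.Icc (piMap S s) (piMap S s')
    · rw [Set.indicator_of_mem hmem]
      exact cut_le_one _ _ _
    rw [Set.indicator_of_notMem hmem]
    rcases lt_or_ge x (piMap S s) with h | h
    · have h1 : piInv p.R S x < s := by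
        by_contra hge
        exact absurd (piMap_le_of_le_piInv hR.le hx.1.le hxR (not_lt.1 hge)) (not_le.2 h)
      have hu' : u ∉ ball d Y z (piInv p.R S x) := fun h2 => by
        linarith [(mem_ball.1 h2).2, min_le_left (d z u) (d z v)]
      have hv' : v ∉ ball d Y z (piInv p.R S x) := fun h2 => by
        linarith [(mem_ball.1 h2).2, min_le_right (d z u) (d z v)]
      simp [cut, hu', hv']
    · have h1 : s' < piInv p.R S x := by
        refine lt_piInv_of_piMap_lt hR.le hx.1.le hxR ?_
        by_contra h2
        exact hmem ⟨h, not_lt.1 h2⟩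
      have hu' : u ∈ ball d Y z (piInv p.R S x) :=
        mem_ball.2 ⟨hu, (le_max_left _ _).trans h1.le⟩
      have hv' : v ∈ ball d Y z (piInv p.R S x) :=
        mem_ball.2 ⟨hv, (le_max_right _ _).trans h1.le⟩
      simp [cut, hu', hv']
  have htouch : p.radiusLaw.real (Set.Ioi (piMap S s)) ≤
      ∫ x, touch (ball d Y z (piInv p.R S x)) u v ∂p.radiusLaw := by
    rw [← integral_indicator_one measurableSet_Ioi]
    refine integral_mono_ae ((integrable_const (1 : ℝ)).indicator measurableSet_Ioi)
      (integrable_comp_ball_piInv hp d Y z S fun P => touch P u v) ?_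
    filter_upwards [hp.ae_mem_Ioc] with x hx
    have hxR := hx.2.trans hvol
    by_cases hmem : x ∈ Set.Ioi (piMap S s)
    · rw [Set.indicator_of_mem hmem]
      have h1 := lt_piInv_of_piMap_lt hR.le hx.1.le hxR hmem
      rcases min_choice (d z u) (d z v) with h | h
      · exact (touch_eq_one_left v (mem_ball.2 ⟨hu, by rw [← h]; exact h1.le⟩)).ge
      · exact (touch_eq_one_right u (mem_ball.2 ⟨hv, by rw [← h]; exact h1.le⟩)).ge
    · rw [Set.indicator_of_notMem hmem]
      exact touch_nonneg _ _ _
  rw [Params.Tame.radiusLaw_Icc p (piMap_mono S hss)] at hcut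
  rw [hp.radiusLaw_Ioi] at htouch
  refine hcut.trans ((hp.stieltjesF_sub_le (piMap_mono S hss) (δ := d u v) ?_).trans ?_)
  · linarith [piMap_le_add S hss]
  · exact mul_le_mul_of_nonneg_left (by linarith)
      (div_nonneg (hd.nonneg u v) hp.R₀_pos.le)

/-- Three ranges of `d z u`. Beyond `R`, no pair shorter than `R₀` is cut, as radii stay below `R₁`.
Up to `2 * R₀`, `u` is always in the cluster, so the touch probability is 1 and absorbs `2 / ρ ≤ 1`.
In between, the errors `2 / ρ` of the near pairs are charged to the mass of `Ball(z, R₀)`, which the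
cluster always contains. -/
theorem IsCharging.light_step (hc : IsCharging d p u W ℓ σ κ) (hp : p.Tame)
    (hd : IsPseudometric d) (hz : ∀ u ∈ Y, (ball d Y u p.R₀).card ≤ (ball d Y z p.R₀).card)
    (hu : u ∈ Y) (hS : S ⊆ Set.Ioc (3 * p.R₀) p.R₁) (hvol : p.R / 2 ≤ piMap S p.R)
    (hmem : ∀ᵐ x ∂p.radiusLaw, piInv p.R S x ∈ S) :
    ∫ x, ∑ v ∈ Y, W v * cut (ball d Y z (piInv p.R S x)) u v ∂p.radiusLaw ≤
      (2 / p.R₀ + 4 * σ / (κ * p.R₀ * p.ρ)) *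
        ∫ x, ∑ v ∈ Y, ℓ v * touch (ball d Y z (piInv p.R S x)) u v ∂p.radiusLaw := by
  have := hp.isProbabilityMeasure_radiusLaw
  have hR₀ := hp.R₀_pos
  have hκ := hc.κ_pos
  have hρ := hp.ρ_pos
  have hρ2 := hp.ρ_ge
  have hσ := hc.σ_nonneg
  have hDR := hp.R₀_le
  have hR₁ : p.R₁ = p.R - p.R₀ := rfl
  set P : ℝ → Finset V := fun x => ball d Y z (piInv p.R S x) with hP
  have hi : ∀ g : Finset V → ℝ, Integrable (fun x => g (P x)) p.radiusLaw :=
    integrable_comp_ball_piInv hp d Y z S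
  have hpay0 : 0 ≤ ∫ x, ∑ v ∈ Y, ℓ v * touch (P x) u v ∂p.radiusLaw :=
    integral_nonneg fun x => hc.pay_nonneg Y (P x)
  have hK : 0 ≤ 4 * σ / (κ * p.R₀ * p.ρ) := by positivity
  have hE1 : ∫ x, ∑ v ∈ Y, W v * cut (P x) u v ∂p.radiusLaw =
      ∑ v ∈ Y, W v * ∫ x, cut (P x) u v ∂p.radiusLaw := by
    rw [integral_finsetSum _ fun v _ => hi fun T => W v * cut T u v]
    exact Finset.sum_congr rfl fun v _ => integral_const_mul _ _
  have hE2 : ∫ x, ∑ v ∈ Y, ℓ v * touch (P x) u v ∂p.radiusLaw =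
      ∑ v ∈ Y, ℓ v * ∫ x, touch (P x) u v ∂p.radiusLaw := by
    rw [integral_finsetSum _ fun v _ => hi fun T => ℓ v * touch T u v]
    exact Finset.sum_congr rfl fun v _ => integral_const_mul _ _
  have ht0 : ∀ v, 0 ≤ ∫ x, touch (P x) u v ∂p.radiusLaw := fun v =>
    integral_nonneg fun x => touch_nonneg _ _ _
  rcases lt_or_ge p.R (d z u) with hfar | hnear
  · calc ∫ x, ∑ v ∈ Y, W v * cut (P x) u v ∂p.radiusLaw
        ≤ ∫ x, 1 / p.R₀ * ∑ v ∈ Y, ℓ v * touch (P x) u v ∂p.radiusLaw := by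
          refine integral_mono_ae (hi fun T => ∑ v ∈ Y, W v * cut T u v)
            (hi fun T => 1 / p.R₀ * ∑ v ∈ Y, ℓ v * touch T u v) ?_
          filter_upwards [hmem] with x hx
          refine (hc.cut_sum_le (P x) hR₀).trans (le_of_eq ?_)
          have hx1 := (hS hx).2
          have : ∑ v ∈ ball d Y u p.R₀, cut (P x) u v = 0 := by
            refine Finset.sum_eq_zero fun v hv => ?_
            have hv := mem_ball.1 hv
            have hu' : u ∉ P x := fun h => by linarith [(mem_ball.1 h).2]
            have hv' : v ∉ P x := fun h => by
              have h3 := hd.triangle z v u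
              rw [hd.symm v u] at h3
              linarith [(mem_ball.1 h).2]
            simp [cut, hu', hv']
          rw [this, mul_zero, add_zero]
      _ = 1 / p.R₀ * ∫ x, ∑ v ∈ Y, ℓ v * touch (P x) u v ∂p.radiusLaw := integral_const_mul _ _
      _ ≤ _ := by
          refine mul_le_mul_of_nonneg_right ?_ hpay0
          have : 1 / p.R₀ ≤ 2 / p.R₀ := div_le_div_of_nonneg_right (by norm_num) hR₀.le
          linarith
  rcases le_or_gt (d z u) (2 * p.R₀) with hclose | hmid
  · have htouch : ∀ v, ∫ x, touch (P x) u v ∂p.radiusLaw = 1 := fun v => by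
      have : ∀ᵐ x ∂p.radiusLaw, touch (P x) u v = 1 := by
        filter_upwards [hmem] with x hx
        have := (hS hx).1
        exact touch_eq_one_left v (mem_ball.2 ⟨hu, by linarith⟩)
      rw [integral_congr_ae this]
      simp
    calc ∫ x, ∑ v ∈ Y, W v * cut (P x) u v ∂p.radiusLaw
        = ∑ v ∈ Y, W v * ∫ x, cut (P x) u v ∂p.radiusLaw := hE1
      _ ≤ ∑ v ∈ Y, 2 / p.R₀ * (ℓ v * ∫ x, touch (P x) u v ∂p.radiusLaw) := by
          refine Finset.sum_le_sum fun v hv => ?_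
          have h1 := integral_cut_le (z := z) hp hd hvol hu hv
          change ∫ x, cut (P x) u v ∂p.radiusLaw ≤
            d u v / p.R₀ * ((∫ x, touch (P x) u v ∂p.radiusLaw) + 2 / p.ρ) at h1
          rw [htouch v] at h1 ⊢
          have h2 : 2 / p.ρ ≤ 1 := (div_le_one hρ).2 hρ2
          have h3 : d u v / p.R₀ * (1 + 2 / p.ρ) ≤ d u v / p.R₀ * 2 :=
            mul_le_mul_of_nonneg_left (by linarith) (div_nonneg (hd.nonneg u v) hR₀.le)
          calc W v * ∫ x, cut (P x) u v ∂p.radiusLaw ≤ W v * (d u v / p.R₀ * 2) :=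
                mul_le_mul_of_nonneg_left (h1.trans h3) (hc.W_nonneg v)
            _ = 2 / p.R₀ * (W v * d u v) := by ring
            _ ≤ 2 / p.R₀ * (ℓ v * 1) := by
                rw [mul_one]
                exact mul_le_mul_of_nonneg_left (hc.W_mul_le v) (by positivity)
      _ = 2 / p.R₀ * ∫ x, ∑ v ∈ Y, ℓ v * touch (P x) u v ∂p.radiusLaw := by
          rw [hE2, Finset.mul_sum]
      _ ≤ _ := mul_le_mul_of_nonneg_right (by linarith) hpay0
  · classical
    have hterm : ∀ v ∈ Y, W v * ∫ x, cut (P x) u v ∂p.radiusLaw ≤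
        1 / p.R₀ * (ℓ v * ∫ x, touch (P x) u v ∂p.radiusLaw) +
          if d u v ≤ p.R₀ then 2 * σ / p.ρ else 0 := by
      intro v hv
      split_ifs with hclose
      · have h1 := integral_cut_le (z := z) hp hd hvol hu hv
        change ∫ x, cut (P x) u v ∂p.radiusLaw ≤
          d u v / p.R₀ * ((∫ x, touch (P x) u v ∂p.radiusLaw) + 2 / p.ρ) at h1
        have h2 := mul_le_mul_of_nonneg_left h1 (hc.W_nonneg v)
        have h3 : W v * (d u v / p.R₀) * (∫ x, touch (P x) u v ∂p.radiusLaw) ≤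
            1 / p.R₀ * (ℓ v * ∫ x, touch (P x) u v ∂p.radiusLaw) := by
          have : W v * (d u v / p.R₀) ≤ 1 / p.R₀ * ℓ v := by
            rw [← mul_div_assoc, one_div, inv_mul_eq_div]
            exact div_le_div_of_nonneg_right (hc.W_mul_le v) hR₀.le
          calc _ ≤ 1 / p.R₀ * ℓ v * (∫ x, touch (P x) u v ∂p.radiusLaw) :=
                mul_le_mul_of_nonneg_right this (ht0 v)
            _ = _ := by ring
        have h4 : W v * (d u v / p.R₀) * (2 / p.ρ) ≤ 2 * σ / p.ρ := by
          have h5 : d u v / p.R₀ ≤ 1 := (div_le_one hR₀).2 hclose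
          have h6 : W v * (d u v / p.R₀) ≤ σ * 1 :=
            mul_le_mul (hc.W_le v) h5 (div_nonneg (hd.nonneg u v) hR₀.le) hσ
          calc _ ≤ σ * 1 * (2 / p.ρ) := mul_le_mul_of_nonneg_right h6 (by positivity)
            _ = _ := by ring
        linarith
      · have h1 := hc.W_le_of_far hR₀ (not_le.1 hclose).le
        have h2 : ∫ x, cut (P x) u v ∂p.radiusLaw ≤ ∫ x, touch (P x) u v ∂p.radiusLaw :=
          integral_mono (hi fun T => cut T u v) (hi fun T => touch T u v) fun x =>
            cut_le_touch _ _ _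
        have h3 := mul_le_mul h1 h2 (integral_nonneg fun x => cut_nonneg _ _ _)
          (mul_nonneg (by positivity) (hc.ℓ_nonneg v))
        linarith
    have hm : κ * (p.R₀ / 2 * ((ball d Y z p.R₀).card : ℝ)) ≤
        ∫ x, ∑ v ∈ Y, ℓ v * touch (P x) u v ∂p.radiusLaw := by
      have : ∫ _, κ * (p.R₀ / 2 * ((ball d Y z p.R₀).card : ℝ)) ∂p.radiusLaw ≤
          ∫ x, ∑ v ∈ Y, ℓ v * touch (P x) u v ∂p.radiusLaw := by
        refine integral_mono_ae (integrable_const _)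
          (hi fun T => ∑ v ∈ Y, ℓ v * touch T u v) ?_
        filter_upwards [hmem] with x hx
        have := (hS hx).1
        exact hc.mass_le_pay hp hd hz hu hmid.le hnear le_rfl (by linarith)
          (ball_mono d Y z (by linarith))
      simpa using this
    have hcount : ∑ v ∈ Y, (if d u v ≤ p.R₀ then 2 * σ / p.ρ else 0) ≤
        2 * σ / p.ρ * ((ball d Y z p.R₀).card : ℝ) := by
      have hball : (Y.filter fun v => d u v ≤ p.R₀) = ball d Y u p.R₀ := by
        ext v; simp [mem_ball]
      rw [← Finset.sum_filter, hball, Finset.sum_const, nsmul_eq_mul, mul_comm]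
      refine mul_le_mul_of_nonneg_left ?_ (by positivity)
      exact_mod_cast hz u hu
    have hlast : 2 * σ / p.ρ * ((ball d Y z p.R₀).card : ℝ) ≤
        4 * σ / (κ * p.R₀ * p.ρ) * ∫ x, ∑ v ∈ Y, ℓ v * touch (P x) u v ∂p.radiusLaw := by
      calc 2 * σ / p.ρ * ((ball d Y z p.R₀).card : ℝ)
          = 4 * σ / (κ * p.R₀ * p.ρ) * (κ * (p.R₀ / 2 * ((ball d Y z p.R₀).card : ℝ))) := by
            field_simp
            ring
        _ ≤ _ := mul_le_mul_of_nonneg_left hm hK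
    calc ∫ x, ∑ v ∈ Y, W v * cut (P x) u v ∂p.radiusLaw
        = ∑ v ∈ Y, W v * ∫ x, cut (P x) u v ∂p.radiusLaw := hE1
      _ ≤ _ := Finset.sum_le_sum hterm
      _ = 1 / p.R₀ * (∫ x, ∑ v ∈ Y, ℓ v * touch (P x) u v ∂p.radiusLaw) +
          ∑ v ∈ Y, (if d u v ≤ p.R₀ then 2 * σ / p.ρ else 0) := by
          rw [Finset.sum_add_distrib, hE2, Finset.mul_sum]
      _ ≤ 2 / p.R₀ * (∫ x, ∑ v ∈ Y, ℓ v * touch (P x) u v ∂p.radiusLaw) +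
          4 * σ / (κ * p.R₀ * p.ρ) * ∫ x, ∑ v ∈ Y, ℓ v * touch (P x) u v ∂p.radiusLaw := by
          have : 1 / p.R₀ ≤ 2 / p.R₀ := div_le_div_of_nonneg_right (by norm_num) hR₀.le
          have := mul_le_mul_of_nonneg_right this hpay0
          linarith
      _ = _ := by ring

end Light

end Step

/-! ### Bookkeeping over all steps of a deterministic peeling process. -/

section Peeling

variable {V : Type*}

open Classical in
/-- The indicator of the event that both `u` and `v` lie in `P`. -/
noncomputable def both (P : Finset V) (u v : V) : ℝ := if u ∈ P ∧ v ∈ P then 1 else 0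

theorem touch_eq (P : Finset V) (u v : V) : touch P u v = cut P u v + both P u v := by
  unfold touch cut both
  by_cases hu : u ∈ P <;> by_cases hv : v ∈ P <;> simp [hu, hv]

variable [Fintype V]

open Classical in
/-- A process that peels off nonempty clusters `P t` from the remaining spaces `Y t`. -/
structure IsPeeling (Y P : ℕ → Finset V) : Prop where
  zero : Y 0 = Finset.univ
  succ : ∀ t, Y (t + 1) = Y t \ P t
  subset : ∀ t, P t ⊆ Y t
  nonempty : ∀ t, (Y t).Nonempty → (P t).Nonempty

/-- The set of the clusters that a peeling process outputs. -/
def clusters (Y P : ℕ → Finset V) : Set (Set V) := {Q | ∃ t, (Y t).Nonempty ∧ Q = ↑(P t)}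

variable {Y P : ℕ → Finset V}

namespace IsPeeling

theorem antitone (h : IsPeeling Y P) : Antitone Y := by
  classical
  refine antitone_nat_of_succ_le fun t => ?_
  rw [h.succ]
  intro v hv
  exact (Finset.mem_sdiff.1 hv).1

theorem card_add_le (h : IsPeeling Y P) (t : ℕ) : Y t = ∅ ∨ (Y t).card + t ≤ Fintype.card V := by
  classical
  induction t with
  | zero => right; rw [h.zero]; simp
  | succ t ih =>
    rcases (Y t).eq_empty_or_nonempty with he | hne
    · left; rw [h.succ, he, Finset.empty_sdiff]
    · right
      rcases ih with ih | ih
      · exact absurd ih hne.ne_empty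
      have h1 := Finset.card_sdiff_add_card_eq_card (h.subset t)
      have h2 := (h.nonempty t hne).card_pos
      rw [h.succ]
      have h3 : (Y t \ P t).card + (t + 1) ≤ Fintype.card V := by omega
      convert h3

theorem eq_empty (h : IsPeeling Y P) : Y (Fintype.card V) = ∅ := by
  rcases h.card_add_le (Fintype.card V) with h1 | h1
  · exact h1
  · exact Finset.card_eq_zero.1 (by omega)

theorem mem_iff (h : IsPeeling Y P) (t : ℕ) (v : V) : v ∈ Y (t + 1) ↔ v ∈ Y t ∧ v ∉ P t := by
  classical
  rw [h.succ]
  exact Finset.mem_sdiff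

theorem exists_mem (h : IsPeeling Y P) (v : V) : ∃ t, v ∈ P t := by
  by_contra! hno
  have : ∀ t, v ∈ Y t := by
    intro t
    induction t with
    | zero => rw [h.zero]; exact Finset.mem_univ v
    | succ t ih => exact (h.mem_iff t v).2 ⟨ih, hno t⟩
  have h1 := this (Fintype.card V)
  rw [h.eq_empty] at h1
  exact Finset.notMem_empty v h1

theorem notMem_of_lt (h : IsPeeling Y P) {s t : ℕ} (hst : s < t) {v : V} (hs : v ∈ P s) :
    v ∉ Y t := fun ht =>
  ((h.mem_iff s v).1 (h.antitone (Nat.succ_le_of_lt hst) ht)).2 hs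

theorem index_unique (h : IsPeeling Y P) {s t : ℕ} {v : V} (hs : v ∈ P s) (ht : v ∈ P t) :
    s = t := by
  rcases lt_trichotomy s t with hlt | heq | hlt
  · exact absurd (h.subset t ht) (h.notMem_of_lt hlt hs)
  · exact heq
  · exact absurd (h.subset s hs) (h.notMem_of_lt hlt ht)

theorem isPartition (h : IsPeeling Y P) : Setoid.IsPartition (clusters Y P) := by
  constructor
  · rintro ⟨t, hY, he⟩
    obtain ⟨v, hv⟩ := h.nonempty t hY
    have : v ∈ (↑(P t) : Set V) := hv
    rw [← he] at this
    exact this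
  · intro v
    obtain ⟨t, ht⟩ := h.exists_mem v
    refine ⟨↑(P t), ⟨⟨t, ⟨v, h.subset t ht⟩, rfl⟩, ht⟩, ?_⟩
    rintro _ ⟨⟨s, -, rfl⟩, hs⟩
    rw [h.index_unique (Finset.mem_coe.1 hs) ht]

theorem sameCluster_iff (h : IsPeeling Y P) (u v : V) :
    SameCluster (clusters Y P) u v ↔ ∃ t, u ∈ P t ∧ v ∈ P t := by
  constructor
  · rintro ⟨_, ⟨t, -, rfl⟩, hu, hv⟩
    exact ⟨t, hu, hv⟩
  · rintro ⟨t, hu, hv⟩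
    exact ⟨_, ⟨t, ⟨u, h.subset t hu⟩, rfl⟩, hu, hv⟩

theorem lt_card (h : IsPeeling Y P) {t : ℕ} {v : V} (hv : v ∈ P t) : t < Fintype.card V := by
  by_contra hge
  have := h.antitone (not_lt.1 hge) (h.subset t hv)
  rw [h.eq_empty] at this
  exact Finset.notMem_empty v this

open Classical in
theorem sum_both (h : IsPeeling Y P) (u v : V) :
    ∑ t ∈ Finset.range (Fintype.card V), both (P t) u v =
      if SameCluster (clusters Y P) u v then 1 else 0 := by
  rw [h.sameCluster_iff]
  split_ifs with hs
  · obtain ⟨t, hu, hv⟩ := hs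
    rw [Finset.sum_eq_single_of_mem t (Finset.mem_range.2 (h.lt_card hu))]
    · simp [both, hu, hv]
    · intro s _ hne
      have : u ∉ P s := fun hu' => hne (h.index_unique hu' hu)
      simp [both, this]
  · refine Finset.sum_eq_zero fun t _ => ?_
    have : ¬ (u ∈ P t ∧ v ∈ P t) := fun h' => hs ⟨t, h'⟩
    simp [both, this]

/-- A pair with both ends left is touched exactly when it stops being so, and the sum telescopes
from all of `V` to the empty set. -/
theorem sum_touch (h : IsPeeling Y P) (u v : V) :
    ∑ t ∈ Finset.range (Fintype.card V), both (Y t) u v * touch (P t) u v = 1 := by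
  have hstep : ∀ t, both (Y t) u v * touch (P t) u v = both (Y t) u v - both (Y (t + 1)) u v := by
    intro t
    unfold both touch
    have hu := h.mem_iff t u
    have hv := h.mem_iff t v
    by_cases h1 : u ∈ Y t <;> by_cases h2 : v ∈ Y t <;> by_cases h3 : u ∈ P t <;>
      by_cases h4 : v ∈ P t <;> simp [hu, hv, h1, h2, h3, h4]
  rw [Finset.sum_congr rfl fun t _ => hstep t, Finset.sum_range_sub', h.zero, h.eq_empty]
  simp [both]

open Classical in
theorem sum_cut (h : IsPeeling Y P) (u v : V) :
    ∑ t ∈ Finset.range (Fintype.card V), both (Y t) u v * cut (P t) u v =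
      if SameCluster (clusters Y P) u v then 0 else 1 := by
  have hstep : ∀ t, both (Y t) u v * cut (P t) u v =
      both (Y t) u v * touch (P t) u v - both (P t) u v := by
    intro t
    rw [touch_eq, mul_add]
    have : both (Y t) u v * both (P t) u v = both (P t) u v := by
      unfold both
      by_cases h1 : u ∈ P t ∧ v ∈ P t
      · simp [h1, h.subset t h1.1, h.subset t h1.2]
      · simp [h1]
    rw [this, add_sub_cancel_right]
  rw [Finset.sum_congr rfl fun t _ => hstep t, Finset.sum_sub_distrib, h.sum_touch, h.sum_both]
  split_ifs <;> norm_num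

end IsPeeling

open Classical in
/-- The weight of a positive edge, zero for all other pairs. -/
noncomputable def posWeight (G : Instance V) (u v : V) : ℝ :=
  if G.pos.Adj u v then G.weight s(u, v) else 0

open Classical in
/-- The weight of a negative edge, zero for all other pairs. -/
noncomputable def negWeight (G : Instance V) (u v : V) : ℝ :=
  if G.posᶜ.Adj u v then G.weight s(u, v) else 0

/-- The contribution of the pair `u`, `v` to the cost of the fractional solution at `u`. -/
noncomputable def pairCost (G : Instance V) (x : V → V → ℝ) (u v : V) : ℝ :=
  posWeight G u v * x u v + negWeight G u v * (1 - x u v)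

open Classical in
/-- The disagreements at `u` that arise when `P` is cut out of `Y`. -/
noncomputable def stepCost (G : Instance V) (u : V) (Y P : Finset V) : ℝ :=
  if u ∈ Y then
    (∑ v ∈ Y, posWeight G u v * cut P u v) + ∑ v ∈ Y, negWeight G u v * both P u v
  else 0

open Classical in
/-- The fractional cost of the pairs at `u` that vanish when `P` is cut out of `Y`. -/
noncomputable def stepPay (G : Instance V) (x : V → V → ℝ) (u : V) (Y P : Finset V) : ℝ :=
  if u ∈ Y then ∑ v ∈ Y, pairCost G x u v * touch P u v else 0

theorem ite_sum_eq_sum_both (u : V) (Y : Finset V) (g : V → ℝ) [Decidable (u ∈ Y)] :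
    (if u ∈ Y then ∑ v ∈ Y, g v else 0) = ∑ v, g v * both Y u v := by
  classical
  by_cases hu : u ∈ Y
  · simp only [both, hu, if_true, true_and, mul_ite, mul_one, mul_zero]
    rw [← Finset.sum_filter, Finset.filter_univ_mem]
  · simp [both, hu]

theorem IsPeeling.dis_eq (h : IsPeeling Y P) (G : Instance V) (u : V) :
    dis G (clusters Y P) u = ∑ t ∈ Finset.range (Fintype.card V), stepCost G u (Y t) (P t) := by
  classical
  have hstep : ∀ t, stepCost G u (Y t) (P t) =
      ∑ v, (posWeight G u v * (both (Y t) u v * cut (P t) u v) +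
        negWeight G u v * both (P t) u v) := by
    intro t
    unfold stepCost
    rw [← Finset.sum_add_distrib, ite_sum_eq_sum_both]
    refine Finset.sum_congr rfl fun v _ => ?_
    have : both (P t) u v * both (Y t) u v = both (P t) u v := by
      unfold both
      by_cases h1 : u ∈ P t ∧ v ∈ P t
      · simp [h1, h.subset t h1.1, h.subset t h1.2]
      · simp [h1]
    rw [add_mul, mul_assoc (negWeight G u v), this]
    ring
  rw [Finset.sum_congr rfl fun t _ => hstep t, Finset.sum_comm, dis, ← Finset.sum_add_distrib]
  refine Finset.sum_congr rfl fun v _ => ?_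
  rw [Finset.sum_add_distrib, ← Finset.mul_sum, ← Finset.mul_sum, h.sum_cut, h.sum_both]
  unfold posWeight negWeight
  by_cases h1 : SameCluster (clusters Y P) u v <;> simp [h1]

/-- Each pair pays in exactly one step; this turns a uniform rate per step into a bound by `y u`. -/
theorem IsPeeling.sum_stepPay (h : IsPeeling Y P) {G : Instance V} {x : V → V → ℝ} {y : V → ℝ}
    (hf : IsFeasible G x y) (u : V) :
    ∑ t ∈ Finset.range (Fintype.card V), stepPay G x u (Y t) (P t) = y u := by
  classical
  have hstep : ∀ t, stepPay G x u (Y t) (P t) =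
      ∑ v, pairCost G x u v * (both (Y t) u v * touch (P t) u v) := by
    intro t
    unfold stepPay
    rw [ite_sum_eq_sum_both]
    exact Finset.sum_congr rfl fun v _ => by ring
  rw [Finset.sum_congr rfl fun t _ => hstep t, Finset.sum_comm, hf.cost, ← Finset.sum_add_distrib]
  refine Finset.sum_congr rfl fun v _ => ?_
  rw [← Finset.mul_sum, h.sum_touch, mul_one]
  unfold pairCost posWeight negWeight
  simp only [ite_mul, zero_mul]

end Peeling

/-! ### Randomness and independence of the iterations. -/

section Iteration

variable {V : Type*} {d : V → V → ℝ} {p : Params} {pivot : Finset V → V}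

theorem clusterSelect_subset (d : V → V → ℝ) (p : Params) (pivot : Finset V → V) (Y : Finset V)
    (x : ℝ) : clusterSelect d p pivot Y x ⊆ Y := by
  unfold clusterSelect
  split_ifs <;> exact ball_subset _ _ _ _

theorem clusterSelect_nonempty (hp : p.Tame) (hd : IsPseudometric d)
    (hpiv : IsPivotRule d p pivot) {Y : Finset V} (hY : Y.Nonempty) (x : ℝ) :
    (clusterSelect d p pivot Y x).Nonempty := by
  have hR₁ : p.R₁ = p.R - p.R₀ := rfl
  have hz := (hpiv Y hY).1
  have hR₀ := hp.R₀_pos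
  have hR := hp.R₀_le
  refine ⟨pivot Y, ?_⟩
  unfold clusterSelect
  split_ifs
  · exact mem_ball.2 ⟨hz, by rw [hd.self]; linarith⟩
  · exact mem_ball.2 ⟨hz, by rw [hd.self]; exact piInv_nonneg _ _ _⟩

variable [Fintype V]

theorem isPeeling_remaining (hp : p.Tame) (hd : IsPseudometric d) (hpiv : IsPivotRule d p pivot)
    (ω : ℕ → ℝ) :
    IsPeeling (remaining d p pivot ω)
      fun t => clusterSelect d p pivot (remaining d p pivot ω t) (ω t) where
  zero := rfl
  succ _ := rfl
  subset _ := clusterSelect_subset _ _ _ _ _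
  nonempty _ hY := clusterSelect_nonempty hp hd hpiv hY _

theorem partitionScheme_eq (d : V → V → ℝ) (p : Params) (pivot : Finset V → V) (ω : ℕ → ℝ) :
    partitionScheme d p pivot ω = clusters (remaining d p pivot ω)
      fun t => clusterSelect d p pivot (remaining d p pivot ω t) (ω t) := rfl

theorem remaining_congr {ω ω' : ℕ → ℝ} {t : ℕ} (h : ∀ i < t, ω i = ω' i) :
    remaining d p pivot ω t = remaining d p pivot ω' t := by
  induction t with
  | zero => rfl
  | succ t ih =>
    rw [remaining, remaining, ih fun i hi => h i (by omega), h t (by omega)]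

theorem measurableSet_remaining (hp : p.Tame) (t : ℕ) (Y : Finset V) :
    MeasurableSet {ω | remaining d p pivot ω t = Y} := by
  classical
  induction t generalizing Y with
  | zero =>
    simp only [remaining]
    exact MeasurableSet.const _
  | succ t ih =>
    -- The event is split by the previous state and encoded by a real-valued indicator, the form in
    -- which measurability of `clusterSelect` was proved.
    have : {ω | remaining d p pivot ω (t + 1) = Y} = ⋃ Z : Finset V,
        {ω | remaining d p pivot ω t = Z} ∩
          (fun ω : ℕ → ℝ => (fun T => if Z \ T = Y then (1 : ℝ) else 0)
            (clusterSelect d p pivot Z (ω t))) ⁻¹' {1} := by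
      ext ω
      simp only [Set.mem_ofPred_eq, Set.mem_iUnion, Set.mem_inter_iff, exists_eq_left',
        Set.mem_preimage, Set.mem_singleton_iff]
      rw [remaining]
      constructor
      · intro h
        rw [if_pos]
        convert h
      · intro h
        by_contra hne
        rw [if_neg] at h
        · exact zero_ne_one h
        · intro h'
          apply hne
          convert h'
    rw [this]
    refine MeasurableSet.iUnion fun Z => (ih Z).inter ?_
    have hm := measurable_comp_clusterSelect d hp pivot Z
      fun T => if Z \ T = Y then (1 : ℝ) else 0
    exact (hm.comp (measurable_pi_apply t)) (measurableSet_singleton 1)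

-- The state before iteration `t` depends only on draws of index below `t`. Padding these by zeros
-- (`ext`) exhibits it as a function of finitely many coordinates, disjoint from coordinate `t`.
open Classical in
theorem indepFun_remaining (hp : p.Tame) (t : ℕ) (Y : Finset V) {g : ℝ → ℝ} (hg : Measurable g) :
    ProbabilityTheory.IndepFun
      (fun ω => if remaining d p pivot ω t = Y then (1 : ℝ) else 0) (fun ω => g (ω t))
      p.seedLaw := by
  have := hp.isProbabilityMeasure_radiusLaw
  have hind : ProbabilityTheory.iIndepFun (fun (i : ℕ) (ω : ℕ → ℝ) => ω i) p.seedLaw :=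
    ProbabilityTheory.iIndepFun_infinitePi (P := fun _ => p.radiusLaw) (X := fun _ x => x)
      fun _ => measurable_id
  have h2 := hind.indepFun_finset (Finset.range t) {t} (by simp) fun i => measurable_pi_apply i
  let ext : (Finset.range t → ℝ) → ℕ → ℝ := fun s i =>
    if h : i ∈ Finset.range t then s ⟨i, h⟩ else 0
  have hext : Measurable ext := by
    refine measurable_pi_iff.2 fun i => ?_
    by_cases h : i ∈ Finset.range t
    · simp only [ext, h, dif_pos]
      exact measurable_pi_apply _
    · simp only [ext, h, dif_neg, not_false_iff]
      exact measurable_const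
  let φ : (Finset.range t → ℝ) → ℝ := fun s =>
    if remaining d p pivot (ext s) t = Y then 1 else 0
  have hφ : Measurable φ :=
    Measurable.ite (hext (measurableSet_remaining hp t Y)) measurable_const measurable_const
  let ψ : (({t} : Finset ℕ) → ℝ) → ℝ := fun s => g (s ⟨t, Finset.mem_singleton_self t⟩)
  have hψ : Measurable ψ := hg.comp (measurable_pi_apply _)
  have h3 := h2.comp hφ hψ
  have e : (fun ω => if remaining d p pivot ω t = Y then (1 : ℝ) else 0) =
      φ ∘ fun (ω : ℕ → ℝ) (i : Finset.range t) => ω i := by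
    funext ω
    have : remaining d p pivot (ext fun i : Finset.range t => ω i) t =
        remaining d p pivot ω t := by
      refine remaining_congr fun i hi => ?_
      simp [ext, hi]
    simp only [φ, Function.comp_apply, this]
  rw [e]
  exact h3

/-- Conditioning on the finitely many states separates the dependence on the past from that on the
current draw. -/
theorem sum_ite_remaining (g : Finset V → Finset V → ℝ) (ω : ℕ → ℝ) (t : ℕ)
    [DecidableEq (Finset V)] :
    g (remaining d p pivot ω t) (clusterSelect d p pivot (remaining d p pivot ω t) (ω t)) =
      ∑ Z : Finset V, (if remaining d p pivot ω t = Z then (1 : ℝ) else 0) *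
        g Z (clusterSelect d p pivot Z (ω t)) := by
  simp

theorem measurable_step (hp : p.Tame) (t : ℕ) (g : Finset V → Finset V → ℝ) :
    Measurable fun ω => g (remaining d p pivot ω t)
      (clusterSelect d p pivot (remaining d p pivot ω t) (ω t)) := by
  classical
  simp only [sum_ite_remaining]
  refine Finset.measurable_fun_sum _ fun Z _ => Measurable.mul ?_ ?_
  · exact Measurable.ite (measurableSet_remaining hp t Z) measurable_const measurable_const
  · exact (measurable_comp_clusterSelect d hp pivot Z (g Z)).comp (measurable_pi_apply t)

theorem integrable_step (hp : p.Tame) (t : ℕ) (g : Finset V → Finset V → ℝ) :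
    Integrable (fun ω => g (remaining d p pivot ω t)
      (clusterSelect d p pivot (remaining d p pivot ω t) (ω t))) p.seedLaw := by
  have := hp.isProbabilityMeasure_seedLaw
  obtain ⟨C, hC⟩ := (Set.finite_range fun T : Finset V × Finset V => ‖g T.1 T.2‖).bddAbove
  exact Integrable.of_bound (measurable_step hp t g).aestronglyMeasurable C
    (Filter.Eventually.of_forall fun ω => hC ⟨(_, _), rfl⟩)

/-- A drift condition for single steps carries over to the steps of the process. -/
theorem integral_step_nonpos (hp : p.Tame) (t : ℕ) (g : Finset V → Finset V → ℝ)
    (hg : ∀ Y, ∫ x, g Y (clusterSelect d p pivot Y x) ∂p.radiusLaw ≤ 0) :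
    ∫ ω, g (remaining d p pivot ω t)
      (clusterSelect d p pivot (remaining d p pivot ω t) (ω t)) ∂p.seedLaw ≤ 0 := by
  classical
  have := hp.isProbabilityMeasure_radiusLaw
  have := hp.isProbabilityMeasure_seedLaw
  simp only [sum_ite_remaining]
  have hm1 : ∀ Z, Measurable fun ω => if remaining d p pivot ω t = Z then (1 : ℝ) else 0 :=
    fun Z => Measurable.ite (measurableSet_remaining hp t Z) measurable_const measurable_const
  have hm2 : ∀ Z, Measurable fun x => g Z (clusterSelect d p pivot Z x) :=
    fun Z => measurable_comp_clusterSelect d hp pivot Z (g Z)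
  have hm3 : ∀ Z, Measurable fun ω : ℕ → ℝ => g Z (clusterSelect d p pivot Z (ω t)) :=
    fun Z => (hm2 Z).comp (measurable_pi_apply t)
  have hint : ∀ Z, Integrable (fun ω => (if remaining d p pivot ω t = Z then (1 : ℝ) else 0) *
      g Z (clusterSelect d p pivot Z (ω t))) p.seedLaw := by
    intro Z
    obtain ⟨C, hC⟩ := (Set.finite_range fun T : Finset V => ‖g Z T‖).bddAbove
    have hb : ∀ ω : ℕ → ℝ, ‖g Z (clusterSelect d p pivot Z (ω t))‖ ≤ C := fun ω => hC ⟨_, rfl⟩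
    refine Integrable.of_bound ((hm1 Z).mul (hm3 Z)).aestronglyMeasurable C
      (Filter.Eventually.of_forall fun ω => ?_)
    have h0 := (norm_nonneg _).trans (hb ω)
    split_ifs
    · rw [one_mul]; exact hb ω
    · rw [zero_mul, norm_zero]; exact h0
  rw [integral_finsetSum _ fun Z _ => hint Z]
  refine Finset.sum_nonpos fun Z _ => ?_
  rw [(indepFun_remaining hp t Z (hm2 Z)).integral_fun_mul_eq_mul_integral
    (hm1 Z).aestronglyMeasurable (hm3 Z).aestronglyMeasurable]
  refine mul_nonpos_of_nonneg_of_nonpos (integral_nonneg fun ω => ?_) ?_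
  · change (0 : ℝ) ≤ if _ then 1 else 0
    split_ifs <;> norm_num
  · have hmp := measurePreserving_eval_infinitePi (fun _ : ℕ => p.radiusLaw) t
    have := integral_map (μ := p.seedLaw) hmp.measurable.aemeasurable
      (f := fun x => g Z (clusterSelect d p pivot Z x)) (hm2 Z).aestronglyMeasurable
    rw [Params.seedLaw, hmp.map_eq] at this
    exact this.symm.le.trans (hg Z)

theorem ae_step (hp : p.Tame) {Q : Finset V → Finset V → Prop}
    (hQ : ∀ Y, ∀ᵐ x ∂p.radiusLaw, Q Y (clusterSelect d p pivot Y x)) :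
    ∀ᵐ ω ∂p.seedLaw, ∀ t, Q (remaining d p pivot ω t)
      (clusterSelect d p pivot (remaining d p pivot ω t) (ω t)) := by
  have := hp.isProbabilityMeasure_radiusLaw
  rw [ae_all_iff]
  intro t
  have hmp := measurePreserving_eval_infinitePi (fun _ : ℕ => p.radiusLaw) t
  -- A single null set serves all of the finitely many `Y`, so the random state can be substituted
  -- without independence.
  have h1 : ∀ᵐ x ∂p.radiusLaw, ∀ Y : Finset V, Q Y (clusterSelect d p pivot Y x) :=
    ae_all_iff.2 hQ
  filter_upwards [hmp.quasiMeasurePreserving.ae h1] with ω hω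
  exact hω _

end Iteration

/-! ### Numerical estimates for the parameters of the algorithm. -/

section Numerics

variable {a : ℝ}

theorem le_log_one_div (ha : 0 < a) (ha' : a ≤ Real.exp (-100)) : 100 ≤ Real.log (1 / a) := by
  rw [Real.le_log_iff_exp_le (by positivity), le_one_div (Real.exp_pos _) ha, one_div,
    ← Real.exp_neg]
  exact ha'

theorem sqrt_le_of_le_exp (ha' : a ≤ Real.exp (-100)) : √a ≤ 1 / 1000 := by
  have h1 : √a ≤ Real.exp (-50) := by
    rw [Real.sqrt_le_left (Real.exp_pos _).le, ← Real.exp_nat_mul]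
    norm_num
    exact ha'
  refine h1.trans ?_
  rw [Real.exp_neg, ← one_div]
  refine one_div_le_one_div_of_le (by norm_num) ?_
  have := Real.quadratic_le_exp_of_nonneg (x := 50) (by norm_num)
  norm_num at this
  linarith

theorem algParams_β (a : ℝ) : (algParams a).β = 3 * √a / Real.log (1 / a) := by
  simp only [Params.β, algParams]
  ring

theorem algParams_D (ha : 0 < a) (ha' : a ≤ Real.exp (-100)) :
    3 * Real.log (1 / a) ≤ (algParams a).D ∧ (algParams a).D ≤ 6 * Real.log (1 / a) := by
  have hL := le_log_one_div ha ha'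
  have hq : 0 < √a := Real.sqrt_pos.2 ha
  set L := Real.log (1 / a) with hLdef
  have e : Real.log (1 / (algParams a).β) = Real.log (L / 3) + L / 2 := by
    have e1 : 1 / (algParams a).β = L / 3 * (1 / √a) := by
      rw [algParams_β, ← hLdef]; field_simp
    have hla : L = -Real.log a := by rw [hLdef, one_div, Real.log_inv]
    rw [e1, Real.log_mul (by positivity) (by positivity), one_div, Real.log_inv,
      Real.log_sqrt ha.le]
    linarith
  have hD : (algParams a).D = 6 * (Real.log (L / 3) + L / 2) := by
    rw [Params.D, e]
    simp only [algParams]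
    ring
  have h1 : 0 ≤ Real.log (L / 3) := Real.log_nonneg (by linarith)
  have h2 := Real.log_le_sub_one_of_pos (show 0 < L / 3 by linarith)
  constructor <;> rw [hD] <;> linarith

theorem tame_algParams (ha : 0 < a) (ha' : a ≤ Real.exp (-100)) : (algParams a).Tame := by
  have hL := le_log_one_div ha ha'
  have hq : 0 < √a := Real.sqrt_pos.2 ha
  have hq' := sqrt_le_of_le_exp ha'
  obtain ⟨hD1, hD2⟩ := algParams_D ha ha'
  have hβ := algParams_β a
  set L := Real.log (1 / a) with hLdef
  have hL0 : 0 < L := by linarith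
  have hr : (algParams a).r = √a / L := rfl
  have hR : (algParams a).R = 1 / 3 := rfl
  have hD0 : 0 < (algParams a).D := by linarith
  refine ⟨?_, ?_, by linarith, ?_, ?_⟩
  · rw [hr]; positivity
  · rw [hR]; norm_num
  · rw [hr, Params.R₀, hR, div_le_div_iff₀ hL0 hD0]
    nlinarith
  · rw [hβ, mul_div_assoc', div_mul_eq_mul_div, div_le_iff₀ hL0]
    nlinarith

theorem algParams_one_div_R₀ (ha : 0 < a) (ha' : a ≤ Real.exp (-100)) :
    1 / (algParams a).R₀ ≤ 18 * Real.log (1 / a) := by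
  have hD := (algParams_D ha ha').2
  have : 1 / (algParams a).R₀ = 3 * (algParams a).D := by
    rw [Params.R₀]
    simp only [algParams]
    rw [one_div_div]
    ring
  linarith

theorem algParams_one_div_ρ (a : ℝ) :
    1 / (algParams a).ρ = (3 * √a / Real.log (1 / a)) ^ 3 := by
  have e : (algParams a).q + 1 = ((3 : ℕ) : ℝ) := by
    simp only [algParams]; norm_num
  rw [Params.ρ, e, Real.rpow_natCast, algParams_β, one_div, ← inv_pow, one_div, inv_inv]

/-- The rate at which the fractional solution pays for the disagreements in expectation. -/
theorem expected_rate_le {a scale : ℝ} (ha : 0 < a) (ha' : a ≤ Real.exp (-100))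
    (hs : 0 < scale) :
    2 / (algParams a).R₀ +
      4 * scale / (a * scale / 2 * (algParams a).R₀ * (algParams a).ρ) + 3 ≤
        40 * Real.log (1 / a) := by
  have hp := tame_algParams ha ha'
  have hL := le_log_one_div ha ha'
  have hq : 0 < √a := Real.sqrt_pos.2 ha
  have hq' := sqrt_le_of_le_exp ha'
  have hR := algParams_one_div_R₀ ha ha'
  have hρ := algParams_one_div_ρ a
  have hR₀ := hp.R₀_pos
  have hρ0 := hp.ρ_pos
  set L := Real.log (1 / a) with hLdef
  have hL0 : 0 < L := by linarith
  have e1 : 4 * scale / (a * scale / 2 * (algParams a).R₀ * (algParams a).ρ) =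
      8 / a * (1 / (algParams a).R₀) * (1 / (algParams a).ρ) := by
    field_simp
    ring
  -- With `q = 2` the factor `1 / ρ` is of order `a * √a / L ^ 3` and beats the `1 / a` lost in `κ`.
  have e2 : 8 / a * (18 * L) * (3 * √a / L) ^ 3 = 3888 * √a / L ^ 2 := by
    have hsq : √a ^ 2 = a := Real.sq_sqrt ha.le
    have h3 : √a ^ 3 = a * √a := by rw [pow_succ, hsq]
    rw [div_pow, mul_pow, h3]
    field_simp
    ring
  have h2 : 8 / a * (1 / (algParams a).R₀) * (1 / (algParams a).ρ) ≤ 3888 * √a / L ^ 2 := by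
    rw [← e2, hρ]
    gcongr
  have h3 : 3888 * √a / L ^ 2 ≤ 1 := by
    rw [div_le_one (by positivity)]
    nlinarith
  have h4 : 2 / (algParams a).R₀ = 2 * (1 / (algParams a).R₀) := by ring
  rw [e1, h4]
  linarith

/-- The rate at which the fractional solution pays for the disagreements almost surely. -/
theorem sure_rate_le {a scale : ℝ} (ha : 0 < a) (ha' : a ≤ Real.exp (-100))
    (hs : 0 < scale) :
    1 / (algParams a).r + scale * (25 * (algParams a).β * (algParams a).D ^ 2 /
      ((algParams a).R * (a * scale / 2))) + 3 ≤ 20000 * (Real.log (1 / a) / √a) := by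
  have hL := le_log_one_div ha ha'
  have hq : 0 < √a := Real.sqrt_pos.2 ha
  have hq' := sqrt_le_of_le_exp ha'
  obtain ⟨hD1, hD2⟩ := algParams_D ha ha'
  have hβ := algParams_β a
  set L := Real.log (1 / a) with hLdef
  have hL0 : 0 < L := by linarith
  have hr : 1 / (algParams a).r = L / √a := by
    change 1 / (√a / L) = L / √a
    rw [one_div_div]
  have hR : (algParams a).R = 1 / 3 := rfl
  have hD0 : 0 ≤ (algParams a).D := by linarith
  have hD3 : (algParams a).D ^ 2 ≤ (6 * L) ^ 2 := pow_le_pow_left₀ hD0 hD2 2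
  have e1 : scale * (25 * (algParams a).β * (algParams a).D ^ 2 /
      ((algParams a).R * (a * scale / 2))) = 450 * √a / (L * a) * (algParams a).D ^ 2 := by
    rw [hβ, hR]
    field_simp
    ring
  -- The choice `r = √a / L` balances `1 / r` against this term, which is of order `r * L ^ 2 / a`.
  have e2 : 450 * √a / (L * a) * (6 * L) ^ 2 = 16200 * (L / √a) := by
    have hsq : a = √a * √a := (Real.mul_self_sqrt ha.le).symm
    have : 450 * √a / (L * a) = 450 / (L * √a) := by
      rw [div_eq_div_iff (by positivity) (by positivity)]
      nth_rewrite 3 [hsq]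
      ring
    rw [this]
    field_simp
    ring
  have h1 : 450 * √a / (L * a) * (algParams a).D ^ 2 ≤ 16200 * (L / √a) := by
    rw [← e2]
    exact mul_le_mul_of_nonneg_left hD3 (by positivity)
  have h2 : 1 ≤ L / √a := by
    rw [le_div_iff₀ hq]; linarith
  rw [hr, e1]
  linarith

end Numerics

/-! ### The charging scheme of the relaxation and the bounds for one step. -/

section Main

variable {V : Type*} {G : Instance V} {x : V → V → ℝ} {y : V → ℝ} {a : ℝ}

theorem posWeight_nonneg (G : Instance V) (u v : V) : 0 ≤ posWeight G u v := by
  unfold posWeight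
  split_ifs with h
  · exact (mul_pos G.α_pos G.scale_pos).le.trans (G.pos_lower u v h)
  · exact le_rfl

theorem negWeight_nonneg (G : Instance V) (u v : V) : 0 ≤ negWeight G u v := by
  unfold negWeight
  split_ifs with h
  · exact (mul_pos G.α_pos G.scale_pos).le.trans (G.neg_lower u v h)
  · exact le_rfl

theorem negWeight_self (G : Instance V) (u : V) : negWeight G u u = 0 := by
  simp [negWeight]

variable [Fintype V]

theorem IsFeasible.isPseudometric (hf : IsFeasible G x y) : IsPseudometric (metricOf x) where
  self u := by simp [metricOf]
  symm u v := by
    unfold metricOf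
    by_cases h : u = v
    · simp [h]
    · simp [h, Ne.symm h, hf.symm u v]
  triangle u v w := by
    unfold metricOf
    have h1 := hf.nonneg
    by_cases huv : u = v
    · subst huv; simp
    by_cases hvw : v = w
    · subst hvw; simp [huv]
    by_cases huw : u = w
    · rw [if_pos huw, if_neg huv, if_neg hvw]
      exact add_nonneg (h1 _ _) (h1 _ _)
    · simp only [huv, hvw, huw, if_false]
      exact hf.triangle u v w

theorem IsFeasible.pairCost_nonneg (hf : IsFeasible G x y) (u v : V) : 0 ≤ pairCost G x u v :=
  add_nonneg (mul_nonneg (posWeight_nonneg G u v) (hf.nonneg u v))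
    (mul_nonneg (negWeight_nonneg G u v) (by linarith [hf.le_one u v]))

/-- The factor 1/2 in `κ` comes from the negative edges: for `x ≤ 2 * R = 2/3` one has `1 - x ≥ x /
2`. -/
theorem IsFeasible.isCharging (hf : IsFeasible G x y) (ha : 0 < a) (haα : a ≤ G.α) (u : V) :
    IsCharging (metricOf x) (algParams a) u (posWeight G u) (pairCost G x u) G.scale
      (a * G.scale / 2) where
  W_nonneg := posWeight_nonneg G u
  W_le v := by
    unfold posWeight
    split_ifs with h
    · exact G.pos_upper u v h
    · exact G.scale_pos.le
  W_mul_le v := by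
    unfold metricOf
    split_ifs with h
    · rw [mul_zero]; exact hf.pairCost_nonneg u v
    · exact le_add_of_nonneg_right
        (mul_nonneg (negWeight_nonneg G u v) (by linarith [hf.le_one u v]))
  κ_pos := by have := G.scale_pos; positivity
  κ_mul_le v hv := by
    have hs := G.scale_pos
    have has : a * G.scale ≤ G.α * G.scale := mul_le_mul_of_nonneg_right haα hs.le
    have has0 : 0 < a * G.scale := mul_pos ha hs
    by_cases huv : u = v
    · have := hf.pairCost_nonneg u v
      simpa [metricOf, huv] using this
    have hm : metricOf x u v = x u v := by simp [metricOf, huv]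
    have hR : (algParams a).R = 1 / 3 := rfl
    rw [hm] at hv ⊢
    rw [hR] at hv
    have hx := hf.nonneg u v
    unfold pairCost posWeight negWeight
    by_cases hadj : G.pos.Adj u v
    · have hn : ¬ G.posᶜ.Adj u v := fun h => ((SimpleGraph.compl_adj _ _ _).1 h).2 hadj
      rw [if_pos hadj, if_neg hn]
      have := mul_le_mul_of_nonneg_right (has.trans (G.pos_lower u v hadj)) hx
      nlinarith
    · have hn : G.posᶜ.Adj u v := (SimpleGraph.compl_adj _ _ _).2 ⟨huv, hadj⟩
      rw [if_neg hadj, if_pos hn]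
      have := mul_le_mul_of_nonneg_right (has.trans (G.neg_lower u v hn))
        (show 0 ≤ 1 - x u v by linarith)
      nlinarith
  ℓ_nonneg := hf.pairCost_nonneg u

/-- Negative edges inside a cluster of radius at most `R` are long. -/
theorem IsFeasible.negWeight_sum_le (hf : IsFeasible G x y) {Y : Finset V} {z u : V} {s : ℝ}
    (hs : s ≤ (algParams a).R) :
    ∑ v ∈ Y, negWeight G u v * both (ball (metricOf x) Y z s) u v ≤
      3 * ∑ v ∈ Y, pairCost G x u v * touch (ball (metricOf x) Y z s) u v := by
  have hd := hf.isPseudometric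
  rw [Finset.mul_sum]
  refine Finset.sum_le_sum fun v _ => ?_
  set P := ball (metricOf x) Y z s with hP
  have hpay : 0 ≤ 3 * (pairCost G x u v * touch P u v) :=
    mul_nonneg (by norm_num) (mul_nonneg (hf.pairCost_nonneg u v) (touch_nonneg _ _ _))
  by_cases hb : u ∈ P ∧ v ∈ P
  · rw [touch_eq_one_left v hb.1, mul_one]
    have hb1 : both P u v = 1 := by simp [both, hb]
    rw [hb1, mul_one]
    by_cases huv : u = v
    · subst huv
      rw [negWeight_self]
      exact mul_nonneg (by norm_num) (hf.pairCost_nonneg u u)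
    have hm : metricOf x u v = x u v := by simp [metricOf, huv]
    have hR : (algParams a).R = 1 / 3 := rfl
    have h1 := hd.triangle u z v
    rw [hd.symm u z, hm] at h1
    have h2 := (mem_ball.1 hb.1).2
    have h3 := (mem_ball.1 hb.2).2
    have h4 : 0 ≤ posWeight G u v * x u v := mul_nonneg (posWeight_nonneg G u v) (hf.nonneg u v)
    have h5 := negWeight_nonneg G u v
    -- Both ends lie within 1/3 of `z`, so `x u v ≤ 2/3`.
    have h6 : negWeight G u v * (1 / 3) ≤ negWeight G u v * (1 - x u v) :=
      mul_le_mul_of_nonneg_left (by linarith) h5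
    unfold pairCost
    linarith
  · have hb0 : both P u v = 0 := by simp [both, hb]
    rw [hb0, mul_zero]
    exact hpay

variable {pivot : Finset V → V}

theorem IsFeasible.stepPay_nonneg (hf : IsFeasible G x y) (u : V) (Y P : Finset V) :
    0 ≤ stepPay G x u Y P := by
  unfold stepPay
  split_ifs
  · exact Finset.sum_nonneg fun v _ =>
      mul_nonneg (hf.pairCost_nonneg u v) (touch_nonneg _ _ _)
  · exact le_rfl

theorem IsFeasible.heavy_stepCost_le (hf : IsFeasible G x y) (ha : 0 < a)
    (ha' : a ≤ Real.exp (-100)) (haα : a ≤ G.α)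
    (hpiv : IsPivotRule (metricOf x) (algParams a) pivot) (u : V) {Y : Finset V}
    (hY : (algParams a).ρ * ((ball (metricOf x) Y (pivot Y) (algParams a).R₀).card : ℝ) ≤
      ((ball (metricOf x) Y (pivot Y) (algParams a).R₁).card : ℝ)) :
    stepCost G u Y (ball (metricOf x) Y (pivot Y) (algParams a).R₁) ≤
      40 * Real.log (1 / a) * stepPay G x u Y (ball (metricOf x) Y (pivot Y) (algParams a).R₁) := by
  have hp := tame_algParams ha ha'
  have hpay := hf.stepPay_nonneg u Y (ball (metricOf x) Y (pivot Y) (algParams a).R₁)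
  by_cases hu : u ∈ Y
  · have hz := (hpiv Y ⟨u, hu⟩).2
    have hc := hf.isCharging ha haα u
    have h1 := hc.heavy_step hp hf.isPseudometric hz hu hY
    have h2 := hf.negWeight_sum_le (Y := Y) (z := pivot Y) (u := u)
      (show (algParams a).R₁ ≤ (algParams a).R from sub_le_self _ hp.R₀_pos.le)
    have h3 := expected_rate_le ha ha' G.scale_pos
    have hκ := hc.κ_pos
    have hR₀ := hp.R₀_pos
    have hρ := hp.ρ_pos
    have hs := G.scale_pos
    have h4 : 1 / (algParams a).R₀ +
        2 * G.scale / (a * G.scale / 2 * (algParams a).R₀ * (algParams a).ρ) + 3 ≤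
        40 * Real.log (1 / a) := by
      refine le_trans ?_ h3
      gcongr <;> norm_num
    unfold stepCost stepPay at *
    simp only [hu, if_true] at hpay ⊢
    have h5 := mul_le_mul_of_nonneg_right h4 hpay
    linarith
  · simp [stepCost, stepPay, hu]

theorem IsFeasible.light_good (hf : IsFeasible G x y) (ha : 0 < a) (ha' : a ≤ Real.exp (-100))
    (hpiv : IsPivotRule (metricOf x) (algParams a) pivot) {Y : Finset V} (hYne : Y.Nonempty)
    (hY : ¬ (algParams a).ρ * ((ball (metricOf x) Y (pivot Y) (algParams a).R₀).card : ℝ) ≤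
      ((ball (metricOf x) Y (pivot Y) (algParams a).R₁).card : ℝ)) :
    (algParams a).R / 2 ≤
      piMap (goodRadii (metricOf x) (algParams a) Y (pivot Y)) (algParams a).R ∧
    ∀ᵐ t ∂(algParams a).radiusLaw,
      piInv (algParams a).R (goodRadii (metricOf x) (algParams a) Y (pivot Y)) t ∈
        goodRadii (metricOf x) (algParams a) Y (pivot Y) := by
  have hp := tame_algParams ha ha'
  have hz := hpiv Y hYne
  have hvol := half_le_piMap_goodRadii hp hf.isPseudometric hz.1 hz.2 (not_le.1 hY)
  exact ⟨hvol, piInv_mem_ae hp (ball_mono (metricOf x) Y (pivot Y)) _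
    (goodRadii_eq (metricOf x) (algParams a) Y (pivot Y)) hvol⟩

theorem IsFeasible.stepCost_le_ae (hf : IsFeasible G x y) (ha : 0 < a)
    (ha' : a ≤ Real.exp (-100)) (haα : a ≤ G.α)
    (hpiv : IsPivotRule (metricOf x) (algParams a) pivot) (u : V) (Y : Finset V) :
    ∀ᵐ t ∂(algParams a).radiusLaw,
      stepCost G u Y (clusterSelect (metricOf x) (algParams a) pivot Y t) ≤
        20000 * (Real.log (1 / a) / √a) *
          stepPay G x u Y (clusterSelect (metricOf x) (algParams a) pivot Y t) := by
  have hp := tame_algParams ha ha'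
  by_cases hu : u ∈ Y
  swap
  · simp [stepCost, stepPay, hu]
  unfold clusterSelect
  split_ifs with hY
  · refine Filter.Eventually.of_forall fun t => ?_
    refine (hf.heavy_stepCost_le ha ha' haα hpiv u hY).trans
      (mul_le_mul_of_nonneg_right ?_ (hf.stepPay_nonneg _ _ _))
    have hL := le_log_one_div ha ha'
    have hq := sqrt_le_of_le_exp ha'
    have h1 : Real.log (1 / a) ≤ Real.log (1 / a) / √a := by
      rw [le_div_iff₀ (Real.sqrt_pos.2 ha)]
      nlinarith
    linarith
  · obtain ⟨-, hmem⟩ := hf.light_good ha ha' hpiv ⟨u, hu⟩ hY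
    filter_upwards [hmem] with t ht
    have hc := hf.isCharging ha haα u
    have h1 := hc.good_step hp ht.2 hu
    have h2 := hf.negWeight_sum_le (Y := Y) (z := pivot Y) (u := u)
      (show _ ≤ (algParams a).R from ht.1.2.trans (sub_le_self _ hp.R₀_pos.le))
    have h3 := sure_rate_le ha ha' G.scale_pos
    have hpay := hf.stepPay_nonneg u Y (ball (metricOf x) Y (pivot Y)
      (piInv (algParams a).R (goodRadii (metricOf x) (algParams a) Y (pivot Y)) t))
    unfold stepCost stepPay at *
    simp only [hu, if_true] at hpay ⊢
    have h5 := mul_le_mul_of_nonneg_right h3 hpay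
    linarith

theorem IsFeasible.integral_stepCost_le (hf : IsFeasible G x y) (ha : 0 < a)
    (ha' : a ≤ Real.exp (-100)) (haα : a ≤ G.α)
    (hpiv : IsPivotRule (metricOf x) (algParams a) pivot) (u : V) (Y : Finset V) :
    ∫ t, (stepCost G u Y (clusterSelect (metricOf x) (algParams a) pivot Y t) -
      40 * Real.log (1 / a) *
        stepPay G x u Y (clusterSelect (metricOf x) (algParams a) pivot Y t))
      ∂(algParams a).radiusLaw ≤ 0 := by
  have hp := tame_algParams ha ha'
  have := hp.isProbabilityMeasure_radiusLaw
  by_cases hu : u ∈ Y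
  swap
  · simp [stepCost, stepPay, hu]
  unfold clusterSelect
  split_ifs with hY
  · have := hf.heavy_stepCost_le ha ha' haα hpiv u hY
    rw [integral_const, probReal_univ, one_smul]
    linarith
  · obtain ⟨hvol, hmem⟩ := hf.light_good ha ha' hpiv ⟨u, hu⟩ hY
    have hc := hf.isCharging ha haα u
    set S := goodRadii (metricOf x) (algParams a) Y (pivot Y) with hS
    set P : ℝ → Finset V := fun t => ball (metricOf x) Y (pivot Y) (piInv (algParams a).R S t)
      with hP
    have hi : ∀ g : Finset V → ℝ, Integrable (fun t => g (P t)) (algParams a).radiusLaw :=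
      integrable_comp_ball_piInv hp _ Y _ S
    have h1 := hc.light_step hp hf.isPseudometric (hpiv Y ⟨u, hu⟩).2 hu
      (fun s hs => hs.1) hvol hmem
    have h2 : ∫ t, ∑ v ∈ Y, negWeight G u v * both (P t) u v ∂(algParams a).radiusLaw ≤
        ∫ t, 3 * ∑ v ∈ Y, pairCost G x u v * touch (P t) u v ∂(algParams a).radiusLaw := by
      refine integral_mono_ae (hi fun T => ∑ v ∈ Y, negWeight G u v * both T u v)
        (hi fun T => 3 * ∑ v ∈ Y, pairCost G x u v * touch T u v) ?_
      filter_upwards [hmem] with t ht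
      exact hf.negWeight_sum_le
        (show _ ≤ (algParams a).R from ht.1.2.trans (sub_le_self _ hp.R₀_pos.le))
    rw [integral_const_mul] at h2
    have h3 := expected_rate_le ha ha' G.scale_pos
    have hpay : 0 ≤ ∫ t, ∑ v ∈ Y, pairCost G x u v * touch (P t) u v ∂(algParams a).radiusLaw :=
      integral_nonneg fun t => hc.pay_nonneg Y (P t)
    have e1 : ∀ T, stepCost G u Y T = (∑ v ∈ Y, posWeight G u v * cut T u v) +
        ∑ v ∈ Y, negWeight G u v * both T u v := fun T => by simp [stepCost, hu]
    have e2 : ∀ T, stepPay G x u Y T = ∑ v ∈ Y, pairCost G x u v * touch T u v :=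
      fun T => by simp [stepPay, hu]
    simp only [e1, e2]
    rw [integral_sub
      (hi fun T => (∑ v ∈ Y, posWeight G u v * cut T u v) +
        ∑ v ∈ Y, negWeight G u v * both T u v)
      (hi fun T => 40 * Real.log (1 / a) * ∑ v ∈ Y, pairCost G x u v * touch T u v),
      integral_add (hi fun T => ∑ v ∈ Y, posWeight G u v * cut T u v)
        (hi fun T => ∑ v ∈ Y, negWeight G u v * both T u v), integral_const_mul]
    have h5 := mul_le_mul_of_nonneg_right h3 hpay
    change ∫ t, ∑ v ∈ Y, posWeight G u v * cut (P t) u v ∂(algParams a).radiusLaw ≤ _ *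
      ∫ t, ∑ v ∈ Y, pairCost G x u v * touch (P t) u v ∂(algParams a).radiusLaw at h1
    linarith

end Main

end CorrClust

theorem theorem4 :
    ∃ αs C : ℝ, 0 < αs ∧ αs < 1 ∧ 3 * √αs / Real.log (1 / αs) < 1 ∧ 0 < C ∧
      ∀ (V : Type*) [Fintype V] (G : CorrClust.Instance V) (x : V → V → ℝ) (y : V → ℝ),
        CorrClust.IsFeasible G x y →
        ∀ (a : ℝ), a = min G.α αs →
        ∀ (pivot : Finset V → V),
          CorrClust.IsPivotRule (CorrClust.metricOf x) (CorrClust.algParams a) pivot →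
        ∀ (𝒞 : (ℕ → ℝ) → Set (Set V)),
          𝒞 = CorrClust.partitionScheme (CorrClust.metricOf x) (CorrClust.algParams a) pivot →
        MeasureTheory.IsProbabilityMeasure (CorrClust.algParams a).seedLaw ∧
        (∀ ω, Setoid.IsPartition (𝒞 ω)) ∧
        ∀ u : V,
          (∀ᵐ ω ∂(CorrClust.algParams a).seedLaw,
            CorrClust.dis G (𝒞 ω) u ≤ C * (Real.log (1 / a) / √a) * y u) ∧
          MeasureTheory.Integrable (fun ω => CorrClust.dis G (𝒞 ω) u)
            (CorrClust.algParams a).seedLaw ∧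
          ∫ ω, CorrClust.dis G (𝒞 ω) u ∂(CorrClust.algParams a).seedLaw
            ≤ C * Real.log (1 / a) * y u := by
  open CorrClust in
  -- The bound `a ≤ exp (-100)` yields `log (1 / a) ≥ 100` and `√a ≤ 1 / 1000`. The constant 20000
  -- is needed for the sure bound; 40 suffices in expectation.
  refine ⟨Real.exp (-100), 20000, Real.exp_pos _, by simp, ?_, by norm_num, ?_⟩
  · have h1 := sqrt_le_of_le_exp (le_refl (Real.exp (-100)))
    have h2 : Real.log (1 / Real.exp (-100)) = 100 := by
      rw [one_div, ← Real.exp_neg, Real.log_exp, neg_neg]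
    rw [h2, div_lt_one (by norm_num)]
    linarith
  intro V _ G x y hf a hadef pivot hpiv 𝒞 h𝒞
  have ha : 0 < a := hadef ▸ lt_min G.α_pos (Real.exp_pos _)
  have ha' : a ≤ Real.exp (-100) := hadef ▸ min_le_right _ _
  have haα : a ≤ G.α := hadef ▸ min_le_left _ _
  have hp := tame_algParams ha ha'
  have hprob := hp.isProbabilityMeasure_seedLaw
  have hpeel := isPeeling_remaining hp hf.isPseudometric hpiv
  have hL := le_log_one_div ha ha'
  subst h𝒞
  have hdis : ∀ u, (fun ω => dis G (partitionScheme (metricOf x) (algParams a) pivot ω) u) =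
      fun ω => ∑ t ∈ Finset.range (Fintype.card V),
        stepCost G u (remaining (metricOf x) (algParams a) pivot ω t)
          (clusterSelect (metricOf x) (algParams a) pivot
            (remaining (metricOf x) (algParams a) pivot ω t) (ω t)) := fun u => by
    funext ω
    rw [partitionScheme_eq, (hpeel ω).dis_eq]
  have hpay : ∀ u ω, ∑ t ∈ Finset.range (Fintype.card V),
      stepPay G x u (remaining (metricOf x) (algParams a) pivot ω t)
        (clusterSelect (metricOf x) (algParams a) pivot
          (remaining (metricOf x) (algParams a) pivot ω t) (ω t)) = y u := fun u ω =>
    (hpeel ω).sum_stepPay hf u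
  refine ⟨hprob, fun ω => (hpeel ω).isPartition, fun u => ⟨?_, ?_, ?_⟩⟩
  · filter_upwards [ae_step (Q := fun Y P => stepCost G u Y P ≤
      20000 * (Real.log (1 / a) / √a) * stepPay G x u Y P) hp
      (hf.stepCost_le_ae ha ha' haα hpiv u)] with ω hω
    have h1 := congrFun (hdis u) ω
    rw [h1, ← hpay u ω, Finset.mul_sum]
    exact Finset.sum_le_sum fun t _ => hω t
  · rw [hdis u]
    exact MeasureTheory.integrable_finsetSum _ fun t _ => integrable_step hp t (stepCost G u)
  · rw [hdis u, MeasureTheory.integral_finsetSum _ fun t _ => integrable_step hp t (stepCost G u)]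
    have hstep : ∀ t, ∫ ω, stepCost G u (remaining (metricOf x) (algParams a) pivot ω t)
          (clusterSelect (metricOf x) (algParams a) pivot
            (remaining (metricOf x) (algParams a) pivot ω t) (ω t)) ∂(algParams a).seedLaw ≤
        40 * Real.log (1 / a) *
          ∫ ω, stepPay G x u (remaining (metricOf x) (algParams a) pivot ω t)
            (clusterSelect (metricOf x) (algParams a) pivot
              (remaining (metricOf x) (algParams a) pivot ω t) (ω t)) ∂(algParams a).seedLaw := by
      intro t
      have h1 := integral_step_nonpos hp t
        (fun Y P => stepCost G u Y P - 40 * Real.log (1 / a) * stepPay G x u Y P)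
        (hf.integral_stepCost_le ha ha' haα hpiv u)
      rw [MeasureTheory.integral_sub (integrable_step hp t (stepCost G u))
        (integrable_step hp t fun Y P => 40 * Real.log (1 / a) * stepPay G x u Y P),
        MeasureTheory.integral_const_mul] at h1
      linarith
    refine (Finset.sum_le_sum fun t _ => hstep t).trans ?_
    rw [← Finset.mul_sum,
      ← MeasureTheory.integral_finsetSum _ fun t _ => integrable_step hp t (stepPay G x u)]
    simp only [hpay u]
    -- Nonnegativity of `y u` allows the constant 40 to be relaxed to 20000.
    have hy : 0 ≤ y u := by
      rw [← hpay u fun _ => 0]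
      exact Finset.sum_nonneg fun t _ => hf.stepPay_nonneg _ _ _
    rw [MeasureTheory.integral_const, MeasureTheory.probReal_univ, one_smul]
    exact mul_le_mul_of_nonneg_right (by linarith) hy
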